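/- Let $A$ and $B$ be finite discrete alphabets, let $X\subseteq A^{\mathbb Z}$ be an irreducible shift of finite type, let $Y\subseteq B^{\mathbb Z}$ be a (necessarily sofic) shift space, and let $\pi:X\to Y$ be a factor code, i.e. a continuous surjection commuting with the shift maps. For $x,x'\in X$ with $\pi(x)=\pi(x')$ write $x\to^r x'$ if for every $m\in\mathbb Z$ there are $z\in X$ with $\pi(z)=\pi(x)$ and $n>m$ such that $z_i=x_i$ for all $i\le m$ and $z_i=x'_i$ for all $i\ge n$. Write $x\to^l x'$ if for every $m\in\mathbb Z$ there are $z\in X$ with $\pi(z)=\pi(x)$ and $n<m$ such that $z_i=x'_i$ for all $i\le n$ and $z_i=x_i$ for all $i\ge m$. The points $x,x'$ are right (resp. left) equivalent if $x\to^r x'$ and $x'\to^r x$ (resp. $x\to^l x'$ and $x'\to^l x$). For $y\in Y$ let $d^r_\pi(y)$ (resp. $d^l_\pi(y)$) be the number of right (resp. left) equivalence classes of points of $\pi^{-1}(y)$, and let $d_\pi=\min_{y\in Y}d^r_\pi(y)$ be the class degree of $\pi$. The code $\pi$ is right (resp. left) class-closing if any two points of $X$ with the same image which agree on some $(-\infty,n]$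 (resp. on some $[n,\infty)$) are right (resp. left) equivalent, and bi-class-closing if it is both right and left class-closing. Put $M^r_\pi=\{y\in Y: d^r_\pi(y)>d_\pi\}$ and $M^l_\pi=\{y\in Y: d^l_\pi(y)>d_\pi\}$. Then: 1. $M^r_\pi$ is a subshift of $Y$ (a closed shift-invariant subset, possibly empty) if and only if $\pi$ is right class-closing. 2. $M^l_\pi$ is a subshift of $Y$ if and only if $\pi$ is left class-closing. 3. $M^r_\pi=M^l_\pi$ if and only if $\pi$ is bi-class-closing. -/

import Mathlib

open SymbolicDynamics.FullShift

namespace ClassDegree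

universe u v

variable {A : Type u} {B : Type v} [TopologicalSpace A] [TopologicalSpace B]

/-- The word `w` occurs in some point of the shift space `X`, i.e. `w` is in the language of `X`. -/
def InLanguage (X : Subshift A ℤ) (w : List A) : Prop :=
  ∃ x ∈ X.carrier, ∃ n : ℤ, ∀ (i : ℕ) (h : i < w.length), x (n + i) = w[i]

/-- `X` is irreducible: any two words of its language can be joined, in this order, by a word. -/
def IsIrreducible (X : Subshift A ℤ) : Prop :=
  ∀ u v : List A, InLanguage X u → InLanguage X v → ∃ w : List A, InLanguage X (u ++ w ++ v)

/-- The word `w` of the language of `X` is synchronizing. -/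
def IsSynchronizing (X : Subshift A ℤ) (w : List A) : Prop :=
  InLanguage X w ∧
    ∀ u v : List A, InLanguage X (u ++ w) → InLanguage X (w ++ v) → InLanguage X (u ++ w ++ v)

/-- `X` is a shift of finite type: for some `k`, all its words of length `k` are synchronizing. -/
def IsFiniteType (X : Subshift A ℤ) : Prop :=
  ∃ k : ℕ, ∀ w : List A, w.length = k → InLanguage X w → IsSynchronizing X w

/-- A factor code: a continuous surjective map between shift spaces commuting with the
shift map `(σ x)_i = x_{i+1}`. -/
structure FactorCode (X : Subshift A ℤ) (Y : Subshift B ℤ) where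
  /-- The underlying map. -/
  toFun : X.carrier → Y.carrier
  continuous_toFun : Continuous toFun
  surjective_toFun : Function.Surjective toFun
  map_shift : ∀ x : X.carrier,
    toFun ⟨shift (1 : ℤ) x.1, X.mapsTo 1 x.2⟩ =
      ⟨shift (1 : ℤ) (toFun x).1, Y.mapsTo 1 (toFun x).2⟩

/-- Left asymptotic points: they agree on some `(-∞, n]`. -/
def LeftAsymptotic {X : Subshift A ℤ} (x x' : X.carrier) : Prop :=
  ∃ n : ℤ, ∀ i ≤ n, x.1 i = x'.1 i

/-- Right asymptotic points: they agree on some `[n, ∞)`. -/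
def RightAsymptotic {X : Subshift A ℤ} (x x' : X.carrier) : Prop :=
  ∃ n : ℤ, ∀ i, n ≤ i → x.1 i = x'.1 i

namespace FactorCode

variable {X : Subshift A ℤ} {Y : Subshift B ℤ} (π : FactorCode X Y)

/-- `z` is a right `m`-bridge from `x` to `x'`. -/
def IsRightBridge (m : ℤ) (x x' z : X.carrier) : Prop :=
  π.toFun x = π.toFun x' ∧ π.toFun z = π.toFun x ∧
    ∃ n : ℤ, m < n ∧ (∀ i ≤ m, z.1 i = x.1 i) ∧ (∀ i, n ≤ i → z.1 i = x'.1 i)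

/-- `z` is a left `m`-bridge from `x` to `x'`. -/
def IsLeftBridge (m : ℤ) (x x' z : X.carrier) : Prop :=
  π.toFun x = π.toFun x' ∧ π.toFun z = π.toFun x ∧
    ∃ n : ℤ, n < m ∧ (∀ i ≤ n, z.1 i = x'.1 i) ∧ (∀ i, m ≤ i → z.1 i = x.1 i)

/-- There is a right transition from `x` to `x'`. -/
def RightTransition (x x' : X.carrier) : Prop :=
  ∀ m : ℤ, ∃ z : X.carrier, π.IsRightBridge m x x' z

/-- There is a left transition from `x` to `x'`. -/
def LeftTransition (x x' : X.carrier) : Prop :=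
  ∀ m : ℤ, ∃ z : X.carrier, π.IsLeftBridge m x x' z

/-- Right equivalence of points of `X`. -/
def RightEquivalent (x x' : X.carrier) : Prop :=
  π.RightTransition x x' ∧ π.RightTransition x' x

/-- Left equivalence of points of `X`. -/
def LeftEquivalent (x x' : X.carrier) : Prop :=
  π.LeftTransition x x' ∧ π.LeftTransition x' x

/-- The right transition class of `x`. -/
def rightClass (x : X.carrier) : Set X.carrier := {x' | π.RightEquivalent x x'}

/-- The left transition class of `x`. -/
def leftClass (x : X.carrier) : Set X.carrier := {x' | π.LeftEquivalent x x'}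

/-- The number of right transition classes over `y`. -/
noncomputable def rightClassCount (y : Y.carrier) : ℕ∞ :=
  (π.rightClass '' {x | π.toFun x = y}).encard

/-- The number of left transition classes over `y`. -/
noncomputable def leftClassCount (y : Y.carrier) : ℕ∞ :=
  (π.leftClass '' {x | π.toFun x = y}).encard

/-- The class degree: the minimum over `Y` of the number of right transition classes
(an infimum in `ℕ∞` over a nonempty family is attained). -/
noncomputable def classDegree : ℕ∞ := ⨅ y : Y.carrier, π.rightClassCount y

/-- The points of `Y` with more right classes than the class degree. -/
def rightMultiplicitySet : Set (ℤ → B) :=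
  Subtype.val '' {y : Y.carrier | π.classDegree < π.rightClassCount y}

/-- The points of `Y` with more left classes than the class degree. -/
def leftMultiplicitySet : Set (ℤ → B) :=
  Subtype.val '' {y : Y.carrier | π.classDegree < π.leftClassCount y}

/-- Right class-closing: left asymptotic points with the same image are right equivalent. -/
def IsRightClassClosing : Prop :=
  ∀ x x' : X.carrier, LeftAsymptotic x x' → π.toFun x = π.toFun x' → π.RightEquivalent x x'

/-- Left class-closing: right asymptotic points with the same image are left equivalent. -/
def IsLeftClassClosing : Prop :=
  ∀ x x' : X.carrier, RightAsymptotic x x' → π.toFun x = π.toFun x' → π.LeftEquivalent x x'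

/-- Bi-class-closing: both right and left class-closing. -/
def IsBiClassClosing : Prop := π.IsRightClassClosing ∧ π.IsLeftClassClosing

end FactorCode

/-- The set `M` of configurations is a subshift: closed and shift-invariant (possibly empty). -/
def IsSubshift (M : Set (ℤ → B)) : Prop := ∃ Z : Subshift B ℤ, Z.carrier = M

end ClassDegree

/-! ### Markov shifts, fibers of one-block maps, and bridges -/

namespace ClassDegree

variable {S B : Type*}

/-! In a higher block presentation, X becomes an irreducible Markov shift and π a one-block map, so
transitions are paths over y (`Reach`). Let d be the least size of a set M of symbols that forms a
transition block with some word. Compactness turns a fiber with exactly k right classes into a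
transition block with at most k symbols (`exists_isTransitionBlock_card_le`), so every fiber has at
least d classes. By pigeonhole, a point in which a minimal block recurs to the right has at most d
(`not_hasClasses_of_recurrent`). Hence d is the class degree. Its definition is symmetric in time,
so left classes are treated by reversal.

The core is `eq_of_merge`: over a common image, paths from distinct symbols a, b of a minimal block
never merge. Over a periodic point carrying the block, some power of the relation "a reaches b in
one period" is idempotent, and minimality makes it a partial order. A merging would yield a periodic
point over which a and b reach each other, against antisymmetry.

If π is not right class-closing, put the left tail of a periodic point carrying a minimal block in
front of two left asymptotic, inequivalent points. The symbols of the block give d classes, and one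
symbol carries two inequivalent points, so the new image has d + 1 right classes. Its shifts
converge to a periodic point with only d, so the multiplicity set is not closed. Its left tail
allows at most d left classes, so the two multiplicity sets differ.

If π is right class-closing, one path between two points of a fiber already makes them right
equivalent (`IsClosing.transEquiv`). Inequivalence is then absence of finite paths, which survives
limits, so the set is closed. As paths can be read in both directions, the left and right sets
coincide in the bi-class-closing case. -/

/-- A closed, shift-invariant and irreducible set of configurations in which two configurations
with a common symbol at some position can be glued there: an irreducible Markov shift. -/
structure IsMarkov [TopologicalSpace S] (X : Set (ℤ → S)) : Prop where
  isClosed : IsClosed X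
  shift_mem : ∀ x ∈ X, ∀ k : ℤ, (fun i => x (i + k)) ∈ X
  glue : ∀ x ∈ X, ∀ x' ∈ X, ∀ i, x i = x' i →
    ∃ z ∈ X, (∀ j ≤ i, z j = x j) ∧ ∀ j, i ≤ j → z j = x' j
  join : ∀ x ∈ X, ∀ x' ∈ X, ∃ z ∈ X, ∃ k : ℤ, 0 < k ∧ (∀ j ≤ 0, z j = x j) ∧
    ∀ j, 0 ≤ j → z (j + k) = x' j

/-- The configurations of `X` lying over `y` under the one-block map `φ`. -/
def fiber (X : Set (ℤ → S)) (φ : S → B) (y : ℤ → B) : Set (ℤ → S) :=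
  {x | x ∈ X ∧ ∀ l, φ (x l) = y l}

/-- Some configuration of `X` passes through `s` at `i` and `t` at `j` and lies over `y` in
between. -/
def Reach (X : Set (ℤ → S)) (φ : S → B) (y : ℤ → B) (i j : ℤ) (s t : S) : Prop :=
  ∃ z ∈ X, (∀ l, i ≤ l → l ≤ j → φ (z l) = y l) ∧ z i = s ∧ z j = t

variable {X : Set (ℤ → S)} {φ : S → B} {y y' : ℤ → B}

namespace Reach

lemma of_mem_fiber {x : ℤ → S} (hx : x ∈ fiber X φ y) (i j : ℤ) :
    Reach X φ y i j (x i) (x j) :=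
  ⟨x, hx.1, fun l _ _ => hx.2 l, rfl, rfl⟩

lemma congr {i j : ℤ} {s t : S} (h : Reach X φ y i j s t)
    (hy : ∀ l, i ≤ l → l ≤ j → y l = y' l) : Reach X φ y' i j s t := by
  obtain ⟨z, hz, h1, h2, h3⟩ := h
  exact ⟨z, hz, fun l hi hj => (h1 l hi hj).trans (hy l hi hj), h2, h3⟩

end Reach

section Topological

variable [TopologicalSpace S]

lemma Reach.shift (hX : IsMarkov X) {i j : ℤ} {s t : S} (h : Reach X φ y i j s t) (d : ℤ)
    (hy : ∀ l, i ≤ l → l ≤ j → y' (l + d) = y l) : Reach X φ y' (i + d) (j + d) s t := by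
  obtain ⟨z, hz, h1, h2, h3⟩ := h
  refine ⟨_, hX.shift_mem z hz (-d), fun l hi hj => ?_, by simpa, by simpa⟩
  have h4 := hy (l + -d) (by omega) (by omega)
  have h5 := h1 (l + -d) (by omega) (by omega)
  rw [h5, ← h4]
  congr 1
  ring

lemma Reach.exists_bridge (hX : IsMarkov X) {x x' : ℤ → S} (hx : x ∈ X) (hx' : x' ∈ X)
    {i j : ℤ} (hij : i ≤ j) (h : Reach X φ y i j (x i) (x' j)) :
    ∃ z ∈ X, (∀ l ≤ i, z l = x l) ∧ (∀ l, j ≤ l → z l = x' l) ∧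
      ∀ l, i ≤ l → l ≤ j → φ (z l) = y l := by
  obtain ⟨w, hw, h1, h2, h3⟩ := h
  obtain ⟨z, hz, h4, h5⟩ := hX.glue x hx w hw i h2.symm
  obtain ⟨u, hu, h6, h7⟩ := hX.glue z hz x' hx' j (by rw [h5 j hij, h3])
  refine ⟨u, hu, fun l hl => ?_, h7, fun l hl hl' => ?_⟩
  · rw [h6 l (hl.trans hij), h4 l hl]
  · rw [h6 l hl', h5 l hl, h1 l hl hl']

lemma Reach.trans (hX : IsMarkov X) {i j k : ℤ} (hij : i ≤ j) (hjk : j ≤ k) {s t u : S}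
    (h : Reach X φ y i j s t) (h' : Reach X φ y j k t u) : Reach X φ y i k s u := by
  obtain ⟨w, hw, h1, rfl, rfl⟩ := h
  obtain ⟨w', hw', h1', h2', rfl⟩ := h'
  obtain ⟨z, hz, h4, h5⟩ := hX.glue w hw w' hw' j h2'.symm
  refine ⟨z, hz, fun l hl hl' => ?_, h4 i hij, h5 k hjk⟩
  rcases le_total l j with h | h
  · rw [h4 l h, h1 l hl h]
  · rw [h5 l h, h1' l h hl']

lemma Reach.exists_bridge_through (hX : IsMarkov X) {x x' : ℤ → S} (hx : x ∈ X) (hx' : x' ∈ X)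
    {i t j : ℤ} (hit : i ≤ t) (htj : t ≤ j) {m : S} (h : Reach X φ y i t (x i) m)
    (h' : Reach X φ y t j m (x' j)) :
    ∃ z ∈ X, (∀ l ≤ i, z l = x l) ∧ (∀ l, j ≤ l → z l = x' l) ∧
      (∀ l, i ≤ l → l ≤ j → φ (z l) = y l) ∧ z t = m := by
  have ⟨w, hw, _, h2, h3⟩ := h
  obtain ⟨z, hz, h4, h5, h6⟩ := Reach.exists_bridge hX hx hw hit (by rwa [h3])
  have hzt : z t = m := by rw [h5 t le_rfl, h3]
  obtain ⟨u, hu, h7, h8, h9⟩ := Reach.exists_bridge hX hz hx' htj (by rwa [hzt])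
  refine ⟨u, hu, fun l hl => ?_, h8, fun l hl hl' => ?_, by rw [h7 t le_rfl, hzt]⟩
  · rw [h7 l (hl.trans hit), h4 l hl]
  · rcases le_total l t with h | h
    · rw [h7 l h, h6 l hl h]
    · exact h9 l h hl'

/-- A bridge between two points of a fiber lies in the fiber. -/
lemma Reach.exists_mem_fiber (hX : IsMarkov X) {x x' : ℤ → S} (hx : x ∈ fiber X φ y)
    (hx' : x' ∈ fiber X φ y) {i j : ℤ} (hij : i ≤ j) (h : Reach X φ y i j (x i) (x' j)) :
    ∃ z ∈ fiber X φ y, (∀ l ≤ i, z l = x l) ∧ ∀ l, j ≤ l → z l = x' l := by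
  obtain ⟨z, hz, h1, h2, h3⟩ := h.exists_bridge hX hx.1 hx'.1 hij
  refine ⟨z, ⟨hz, fun l => ?_⟩, h1, h2⟩
  rcases le_total l i with h | h
  · rw [h1 l h, hx.2]
  rcases le_total l j with h' | h'
  · exact h3 l h h'
  · rw [h2 l h', hx'.2]

lemma IsMarkov.join_at (hX : IsMarkov X) {x x' : ℤ → S} (hx : x ∈ X) (hx' : x' ∈ X) (s t : ℤ) :
    ∃ z ∈ X, ∃ d : ℤ, s < t + d ∧ (∀ j ≤ s, z j = x j) ∧ ∀ j, t ≤ j → z (j + d) = x' j := by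
  obtain ⟨z, hz, k, hk, h1, h2⟩ := hX.join _ (hX.shift_mem x hx s) _ (hX.shift_mem x' hx' t)
  refine ⟨_, hX.shift_mem z hz (-s), k + s - t, by omega, fun j hj => ?_, fun j hj => ?_⟩
  · simpa using h1 (j + -s) (by omega)
  · have := h2 (j - t) (by omega)
    rw [show j + (k + s - t) + -s = j - t + k by ring, this]
    congr 1
    ring

/-- A decreasing sequence of nonempty closed sets of functions into a finite discrete space has a
common point. -/
lemma exists_forall_mem_of_antitone {ι : Type*} {T : ι → Type*} [∀ i, TopologicalSpace (T i)]
    [∀ i, CompactSpace (T i)]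
    (C : ℕ → Set (∀ i, T i)) (hanti : ∀ n, C (n + 1) ⊆ C n) (hne : ∀ n, (C n).Nonempty)
    (hcl : ∀ n, IsClosed (C n)) : ∃ x, ∀ n, x ∈ C n := by
  obtain ⟨x, hx⟩ := IsCompact.nonempty_iInter_of_sequence_nonempty_isCompact_isClosed C hanti hne
    (hcl 0).isCompact hcl
  exact ⟨x, fun n => Set.mem_iInter.1 hx n⟩

variable [DiscreteTopology S]

lemma isClosed_setOf_apply {ι : Type*} (i : ι) (P : S → Prop) :
    IsClosed {x : ι → S | P (x i)} :=
  (isClosed_discrete {s | P s}).preimage (continuous_apply i)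

lemma isClosed_setOf_apply₂ {ι : Type*} (i j : ι) (P : S → S → Prop) :
    IsClosed {x : ι → S | P (x i) (x j)} := by
  have h : Continuous fun x : ι → S => (x i, x j) :=
    (continuous_apply i).prodMk (continuous_apply j)
  exact (isClosed_discrete {s : S × S | P s.1 s.2}).preimage h

lemma isClosed_setOf_over (φ : S → B) (y : ℤ → B) (a b : ℤ) :
    IsClosed {x : ℤ → S | ∀ l, a ≤ l → l ≤ b → φ (x l) = y l} := by
  simp only [Set.ofPred_forall]
  exact isClosed_iInter fun l => isClosed_iInter fun _ => isClosed_iInter fun _ =>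
    isClosed_setOf_apply l fun s => φ s = y l

end Topological

end ClassDegree

/-! ### Right classes and transition blocks -/

namespace ClassDegree

variable {S B : Type*} {X : Set (ℤ → S)} {φ : S → B} {y y' : ℤ → B}

/-- Right transitions between points of the fiber over `y`, in terms of `Reach`. -/
def Trans (X : Set (ℤ → S)) (φ : S → B) (y : ℤ → B) (x x' : ℤ → S) : Prop :=
  ∀ m, ∃ n, m ≤ n ∧ Reach X φ y m n (x m) (x' n)

/-- Right equivalence of points of the fiber over `y`. -/
def TransEquiv (X : Set (ℤ → S)) (φ : S → B) (y : ℤ → B) (x x' : ℤ → S) : Prop :=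
  Trans X φ y x x' ∧ Trans X φ y x' x

/-- The fiber over `y` has at least `k` right classes. -/
def HasClasses (X : Set (ℤ → S)) (φ : S → B) (k : ℕ) (y : ℤ → B) : Prop :=
  ∃ f : Fin k → ℤ → S, (∀ c, f c ∈ fiber X φ y) ∧
    ∀ c c', c ≠ c' → ¬ TransEquiv X φ y (f c) (f c')

/-- The word of `y` on `[t - L, t + L]` together with the set `M` of symbols at `t` is a
transition block: each preimage of the word can be rerouted through `M`. -/
def IsTransitionBlock (X : Set (ℤ → S)) (φ : S → B) (y : ℤ → B) (t : ℤ) (L : ℕ)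
    (M : Finset S) : Prop :=
  ∀ x ∈ X, (∀ l, t - L ≤ l → l ≤ t + L → φ (x l) = y l) →
    ∃ z ∈ X, (∀ l, φ (z l) = φ (x l)) ∧ (∀ l ≤ t - L, z l = x l) ∧ (∀ l, t + L ≤ l → z l = x l) ∧
      z t ∈ M

/-- Every transition block of `X` has depth at least `d`. -/
def DepthAtLeast (X : Set (ℤ → S)) (φ : S → B) (d : ℕ) : Prop :=
  ∀ y t L M, (fiber X φ y).Nonempty → IsTransitionBlock X φ y t L M → d ≤ M.card

namespace TransEquiv

lemma symm {x x' : ℤ → S} (h : TransEquiv X φ y x x') : TransEquiv X φ y x' x :=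
  ⟨h.2, h.1⟩

end TransEquiv

lemma HasClasses.of_fintype {ι : Type*} [Fintype ι] {k : ℕ} (hk : Fintype.card ι = k)
    (f : ι → ℤ → S) (hf : ∀ c, f c ∈ fiber X φ y)
    (h : ∀ c c', c ≠ c' → ¬ TransEquiv X φ y (f c) (f c')) : HasClasses X φ k y := by
  let e := Fintype.equivFinOfCardEq hk
  exact ⟨fun c => f (e.symm c), fun c => hf _, fun c c' hc => h _ _ (e.symm.injective.ne hc)⟩

namespace IsTransitionBlock

variable {t : ℤ} {L : ℕ} {M : Finset S}

lemma congr (h : IsTransitionBlock X φ y t L M)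
    (hy : ∀ l, t - L ≤ l → l ≤ t + L → y' l = y l) : IsTransitionBlock X φ y' t L M :=
  fun x hx hxy => h x hx fun l hl hl' => (hxy l hl hl').trans (hy l hl hl')

lemma exists_mem_fiber (h : IsTransitionBlock X φ y t L M) {x : ℤ → S} (hx : x ∈ fiber X φ y) :
    ∃ z ∈ fiber X φ y, (∀ l ≤ t - L, z l = x l) ∧ (∀ l, t + L ≤ l → z l = x l) ∧ z t ∈ M := by
  obtain ⟨z, hz, h1, h2, h3, h4⟩ := h x hx.1 fun l _ _ => hx.2 l
  exact ⟨z, ⟨hz, fun l => (h1 l).trans (hx.2 l)⟩, h2, h3, h4⟩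

/-- Rerouting changes a path only strictly inside the window, so a path covering the window keeps
its ends and can be cut at a symbol of M. -/
lemma exists_reach (h : IsTransitionBlock X φ y t L M) {i j : ℤ} {s u : S} (hi : i ≤ t - L)
    (hj : t + L ≤ j) (hr : Reach X φ y i j s u) :
    ∃ m ∈ M, Reach X φ y i t s m ∧ Reach X φ y t j m u := by
  obtain ⟨x, hx, h1, rfl, rfl⟩ := hr
  obtain ⟨z, hz, h2, h3, h4, h5⟩ := h x hx fun l hl hl' => h1 l (by omega) (by omega)
  exact ⟨z t, h5, ⟨z, hz, fun l hl hl' => (h2 l).trans (h1 l hl (by omega)), h3 i hi, rfl⟩,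
    ⟨z, hz, fun l hl hl' => (h2 l).trans (h1 l (by omega) hl'), rfl, h4 j hj⟩⟩

end IsTransitionBlock

section Topological

variable [TopologicalSpace S]

lemma IsTransitionBlock.shift (hX : IsMarkov X) {t : ℤ} {L : ℕ} {M : Finset S}
    (h : IsTransitionBlock X φ y t L M) (d : ℤ)
    (hy : ∀ l, t - L ≤ l → l ≤ t + L → y' (l + d) = y l) :
    IsTransitionBlock X φ y' (t + d) L M := by
  intro x hx hxy
  obtain ⟨z, hz, h1, h2, h3, h4⟩ := h _ (hX.shift_mem x hx d) fun l hl hl' =>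
    (hxy (l + d) (by omega) (by omega)).trans (hy l hl hl')
  refine ⟨_, hX.shift_mem z hz (-d), fun l => ?_, fun l hl => ?_, fun l hl => ?_, by simpa⟩
  · simpa using h1 (l + -d)
  · simpa using h2 (l + -d) (by omega)
  · simpa using h3 (l + -d) (by omega)

lemma Reach.mono (hX : IsMarkov X) {x x' : ℤ → S} (hx : x ∈ fiber X φ y) (hx' : x' ∈ fiber X φ y)
    {m n m' n' : ℤ} (hmn : m ≤ n) (hm : m' ≤ m) (hn : n ≤ n')
    (h : Reach X φ y m n (x m) (x' n)) : Reach X φ y m' n' (x m') (x' n') :=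
  ((Reach.of_mem_fiber hx m' m).trans hX hm hmn h).trans hX (hm.trans hmn) hn
    (Reach.of_mem_fiber hx' n n')

lemma Trans.trans (hX : IsMarkov X) {x x' x'' : ℤ → S} (h : Trans X φ y x x')
    (h' : Trans X φ y x' x'') : Trans X φ y x x'' := by
  intro m
  obtain ⟨n, hn, h1⟩ := h m
  obtain ⟨p, hp, h2⟩ := h' n
  exact ⟨p, hn.trans hp, h1.trans hX hn hp h2⟩

lemma TransEquiv.trans (hX : IsMarkov X) {x x' x'' : ℤ → S} (h : TransEquiv X φ y x x')
    (h' : TransEquiv X φ y x' x'') : TransEquiv X φ y x x'' :=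
  ⟨h.1.trans hX h'.1, h'.2.trans hX h.2⟩

omit [TopologicalSpace S] in
lemma Trans.of_eventually_eq {x x' : ℤ → S} (hx : x ∈ fiber X φ y) {N : ℤ}
    (h : ∀ l, N ≤ l → x l = x' l) : Trans X φ y x x' := fun m =>
  ⟨max m N, le_max_left _ _, by
    rw [← h _ (le_max_right _ _)]
    exact Reach.of_mem_fiber hx _ _⟩

omit [TopologicalSpace S] in
lemma TransEquiv.of_eventually_eq {x x' : ℤ → S} (hx : x ∈ fiber X φ y)
    (hx' : x' ∈ fiber X φ y) {N : ℤ} (h : ∀ l, N ≤ l → x l = x' l) : TransEquiv X φ y x x' :=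
  ⟨.of_eventually_eq hx h, .of_eventually_eq hx' fun l hl => (h l hl).symm⟩

variable [DiscreteTopology S] [Finite S]

/-- If every point of the fiber over `y` can be rerouted through `M` at `t`, then some word of `y`
around `t` makes a transition block with `M`. -/
lemma exists_isTransitionBlock (hX : IsMarkov X) {t : ℤ} {M : Finset S}
    (h : ∀ x ∈ fiber X φ y, ∃ l : ℕ, ∃ m ∈ M,
      Reach X φ y (t - l) t (x (t - l)) m ∧ Reach X φ y t (t + l) m (x (t + l))) :
    ∃ L, IsTransitionBlock X φ y t L M := by
  by_contra! hcon
  -- The points over the window of radius L that cannot be rerouted through M within it form a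
  -- decreasing sequence of closed sets. A common point would lie in the fiber and contradict `h`.
  let C : ℕ → Set (ℤ → S) := fun L => (X ∩ {x | ∀ l, t - L ≤ l → l ≤ t + L → φ (x l) = y l}) ∩
    {x | ¬ ∃ m ∈ M, Reach X φ y (t - L) t (x (t - L)) m ∧ Reach X φ y t (t + L) m (x (t + L))}
  have hanti : ∀ L, C (L + 1) ⊆ C L := by
    rintro L x ⟨⟨hx, hxy⟩, hr⟩
    push_cast at hxy hr
    refine ⟨⟨hx, fun l hl hl' => hxy l (by omega) (by omega)⟩, fun ⟨m, hm, h1, h2⟩ =>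
      hr ⟨m, hm, ?_, ?_⟩⟩
    · exact Reach.trans hX (j := t - L) (by omega) (by omega)
        ⟨x, hx, fun l hl hl' => hxy l (by omega) (by omega), rfl, rfl⟩ h1
    · exact Reach.trans hX (j := t + L) (by omega) (by omega) h2
        ⟨x, hx, fun l hl hl' => hxy l (by omega) (by omega), rfl, rfl⟩
  have hne : ∀ L, (C L).Nonempty := by
    intro L
    have := hcon L
    simp only [IsTransitionBlock, not_forall] at this
    obtain ⟨x, hx, hxy, hz⟩ := this
    refine ⟨x, ⟨hx, hxy⟩, fun ⟨m, hm, h1, h2⟩ => hz ?_⟩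
    obtain ⟨z, hz, h3, h4, h5, h6⟩ :=
      Reach.exists_bridge_through hX hx hx (by omega) (by omega) h1 h2
    refine ⟨z, hz, fun l => ?_, h3, h4, by rwa [h6]⟩
    by_cases hl : l ≤ t - L
    · rw [h3 l hl]
    by_cases hl' : t + L ≤ l
    · rw [h4 l hl']
    rw [h5 l (by omega) (by omega), hxy l (by omega) (by omega)]
  have hcl : ∀ L, IsClosed (C L) := by
    intro L
    exact (hX.isClosed.inter (isClosed_setOf_over φ y _ _)).inter
      (isClosed_setOf_apply₂ (t - L) (t + L) fun a b =>
        ¬ ∃ m ∈ M, Reach X φ y (t - L) t a m ∧ Reach X φ y t (t + L) m b)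
  obtain ⟨x, hx⟩ := exists_forall_mem_of_antitone C hanti hne hcl
  have hxf : x ∈ fiber X φ y := ⟨(hx 0).1.1, fun l =>
    (hx (l - t).natAbs).1.2 l (by omega) (by omega)⟩
  obtain ⟨l, hl⟩ := h x hxf
  exact (hx l).2 hl

/-- Every symbol of a transition block of minimal depth lies on a point of the fiber. -/
lemma IsTransitionBlock.exists_apply_eq (hX : IsMarkov X) {t : ℤ} {L : ℕ} {M : Finset S}
    (h : IsTransitionBlock X φ y t L M) (hd : DepthAtLeast X φ M.card)
    (hy : (fiber X φ y).Nonempty) {m : S} (hm : m ∈ M) : ∃ x ∈ fiber X φ y, x t = m := by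
  classical
  by_contra! hcon
  -- If no point of the fiber visits m at t, every rerouting already goes through M without m, which
  -- gives a block that is too small.
  obtain ⟨L', hL'⟩ := exists_isTransitionBlock hX (y := y) (φ := φ) (t := t) (M := M.erase m)
    fun x hx => by
      obtain ⟨z, hz, h1, h2, h3⟩ := h.exists_mem_fiber hx
      refine ⟨L, z t, Finset.mem_erase.2 ⟨hcon z hz, h3⟩, ?_, ?_⟩
      · rw [← h1 _ le_rfl]
        exact Reach.of_mem_fiber hz _ _
      · rw [← h2 _ le_rfl]
        exact Reach.of_mem_fiber hz _ _
  have := hd y t L' _ hy hL'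
  have := Finset.card_erase_lt_of_mem hm
  omega

/-- If the fiber over `y` does not have `k + 1` classes, it carries a transition block of depth at
most `k`. -/
lemma exists_isTransitionBlock_card_le (hX : IsMarkov X) {k : ℕ} (h : HasClasses X φ k y)
    (h' : ¬ HasClasses X φ (k + 1) y) :
    ∃ t L M, IsTransitionBlock X φ y t L M ∧ M.card ≤ k := by
  classical
  obtain ⟨f, hf, hne⟩ := h
  have hrep : ∀ x ∈ fiber X φ y, ∃ c, TransEquiv X φ y x (f c) := by
    intro x hx
    by_contra! hcon
    refine h' (HasClasses.of_fintype (ι := Option (Fin k)) (by simp)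
      (fun o => o.elim x f) ?_ ?_)
    · rintro (_ | c)
      exacts [hx, hf c]
    · rintro (_ | c) (_ | c') hc
      · exact absurd rfl hc
      · exact hcon c'
      · exact fun h => hcon c h.symm
      · exact hne c c' fun h => hc (by rw [h])
  -- Once a symbol at 0 reaches a representative, it reaches it at all later times. Finitely many
  -- pairs are involved, so one time n serves them all.
  have hev : ∀ p : S × Fin k, ∃ N : ℕ, (∃ n, 0 ≤ n ∧ Reach X φ y 0 n p.1 (f p.2 n)) →
      ∀ n : ℤ, N ≤ n → Reach X φ y 0 n p.1 (f p.2 n) := by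
    intro p
    by_cases hp : ∃ n, 0 ≤ n ∧ Reach X φ y 0 n p.1 (f p.2 n)
    · obtain ⟨n, hn, hr⟩ := hp
      exact ⟨n.toNat, fun _ n' hn' => hr.trans hX hn (by omega) (Reach.of_mem_fiber (hf _) _ _)⟩
    · exact ⟨0, fun h => absurd h hp⟩
  choose N hN using hev
  obtain ⟨n, hn⟩ : ∃ n, ∀ p, N p ≤ n := by
    obtain ⟨n, hn⟩ := (Set.finite_range N).bddAbove
    exact ⟨n, fun p => hn ⟨p, rfl⟩⟩
  -- M consists of the symbols of the representatives at time n: a point joins its representative by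
  -- time n, and returns to itself afterwards by the opposite transition.
  obtain ⟨L, hL⟩ := exists_isTransitionBlock hX (y := y) (φ := φ) (t := n)
    (M := Finset.univ.image fun c => f c n) fun x hx => by
      obtain ⟨c, h1, h2⟩ := hrep x hx
      have h3 := hN (x 0, c) (h1 0) n (by exact_mod_cast hn _)
      obtain ⟨m, hm, h4⟩ := h2 n
      refine ⟨m.toNat, f c n, Finset.mem_image_of_mem _ (Finset.mem_univ _), ?_, ?_⟩
      · exact (Reach.of_mem_fiber hx _ 0).trans hX (by omega) (by omega) h3
      · exact h4.trans hX (by omega) (by omega) (Reach.of_mem_fiber hx _ _)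
  exact ⟨n, L, _, hL, Finset.card_image_le.trans (by simp)⟩

/-- Every fiber has at least as many right classes as the minimal depth. -/
lemma DepthAtLeast.hasClasses (hX : IsMarkov X) {d : ℕ} (hd : DepthAtLeast X φ d)
    (hy : (fiber X φ y).Nonempty) : HasClasses X φ d y := by
  suffices ∀ k ≤ d, HasClasses X φ k y from this d le_rfl
  intro k
  induction k with
  | zero => exact fun _ => ⟨fun c => c.elim0, fun c => c.elim0, fun c => c.elim0⟩
  | succ k ih =>
    intro hk
    by_contra hcon
    obtain ⟨t, L, M, hM, hle⟩ := exists_isTransitionBlock_card_le hX (ih (by omega)) hcon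
    have := hd y t L M hy hM
    omega

omit [DiscreteTopology S] [Finite S] in
/-- A fiber on which a transition block recurs to the right has at most as many right classes as
the depth of the block. -/
lemma not_hasClasses_of_recurrent (hX : IsMarkov X) {L : ℕ} {M : Finset S}
    (h : ∀ N : ℤ, ∃ t, N ≤ t ∧ IsTransitionBlock X φ y t L M) :
    ¬ HasClasses X φ (M.card + 1) y := by
  classical
  rintro ⟨f, hf, hne⟩
  -- A missing transition is missing from every later starting time, so far enough to the right no
  -- two of the points reach each other mutually. Pigeonhole at a late block will contradict this.
  have hN : ∀ p : Fin (M.card + 1) × Fin (M.card + 1), ∃ N : ℤ, p.1 ≠ p.2 →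
      ∀ m, N ≤ m → ¬ ((∃ n, m ≤ n ∧ Reach X φ y m n (f p.1 m) (f p.2 n)) ∧
        ∃ n, m ≤ n ∧ Reach X φ y m n (f p.2 m) (f p.1 n)) := by
    rintro ⟨a, b⟩
    by_cases hab : a = b
    · exact ⟨0, fun h => absurd hab h⟩
    have := hne a b hab
    simp only [TransEquiv, Trans, not_and_or, not_forall] at this
    rcases this with ⟨N, hN⟩ | ⟨N, hN⟩
    · exact ⟨N, fun _ m hm ⟨⟨n, hn, h1⟩, _⟩ =>
        hN ⟨n, hm.trans hn, h1.mono hX (hf _) (hf _) hn hm le_rfl⟩⟩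
    · exact ⟨N, fun _ m hm ⟨_, n, hn, h1⟩ =>
        hN ⟨n, hm.trans hn, h1.mono hX (hf _) (hf _) hn hm le_rfl⟩⟩
  choose N hN using hN
  obtain ⟨N₀, hN₀⟩ := (Set.finite_range N).bddAbove
  obtain ⟨t, ht, hM⟩ := h (N₀ + L)
  choose g hg using fun c => hM.exists_mem_fiber (hf c)
  obtain ⟨a, -, b, -, hab, hgab⟩ := Finset.exists_ne_map_eq_of_card_lt_of_maps_to
    (s := Finset.univ) (t := M) (f := fun c => g c t) (by simp) (fun c _ => (hg c).2.2.2)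
  have key : ∀ a b, g a t = g b t →
      ∃ n, t - L ≤ n ∧ Reach X φ y (t - L) n (f a (t - L)) (f b n) := by
    intro a b hab
    refine ⟨t + L, by omega, ?_⟩
    rw [← (hg a).2.1 _ le_rfl, ← (hg b).2.2.1 _ le_rfl]
    refine (Reach.of_mem_fiber (hg a).1 _ t).trans hX (by omega) (by omega) ?_
    rw [hab]
    exact Reach.of_mem_fiber (hg b).1 _ _
  have : N (a, b) ≤ N₀ := hN₀ ⟨_, rfl⟩
  exact hN (a, b) hab (t - L) (by omega) ⟨key a b hgab, key b a hgab.symm⟩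

end Topological

end ClassDegree

/-! ### Periodic configurations and the non-merging property of minimal blocks -/

namespace ClassDegree

variable {S B : Type*} {X : Set (ℤ → S)} {φ : S → B} {y y' : ℤ → B}

/-- A configuration all of whose central words are those of members of a closed set belongs to
the set. -/
lemma mem_of_forall_exists_eqOn {T : Type*} [TopologicalSpace T] {C : Set (ℤ → T)}
    (hC : IsClosed C) {x : ℤ → T}
    (h : ∀ n : ℕ, ∃ z ∈ C, ∀ j : ℤ, -n ≤ j → j ≤ n → z j = x j) : x ∈ C := by
  choose z hz hzx using h
  refine hC.mem_of_tendsto (b := Filter.atTop) (f := z) (tendsto_pi_nhds.2 fun j => ?_)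
    (Filter.Eventually.of_forall hz)
  refine tendsto_const_nhds.congr' ?_
  filter_upwards [Filter.eventually_ge_atTop j.natAbs] with n hn
  exact (hzx n j (by omega) (by omega)).symm

/-- In a finite type, a dense transitive relation has a reflexive point between any two related
points. -/
lemma exists_refl_between {α : Type*} [Finite α] {e : α → α → Prop}
    (htrans : ∀ a b c, e a b → e b c → e a c) (hdense : ∀ a c, e a c → ∃ b, e a b ∧ e b c)
    {a c : α} (h : e a c) : ∃ b, e a b ∧ e b b ∧ e b c := by
  by_contra! hcon
  -- Without reflexive points, `r` is a strict order on a finite type, and density produces a point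
  -- below its minimal element.
  let r : {b // e a b ∧ e b c} → {b // e a b ∧ e b c} → Prop := fun b b' => e b.1 b'.1
  have : IsTrans _ r := ⟨fun _ _ _ => htrans _ _ _⟩
  have : Std.Irrefl r := ⟨fun b hb => hcon b.1 b.2.1 hb b.2.2⟩
  obtain ⟨b, h1, h2⟩ := hdense a c h
  obtain ⟨⟨m, hm1, hm2⟩, -, hm⟩ := (Finite.wellFounded_of_trans_of_irrefl r).has_min Set.univ
    ⟨⟨b, h1, h2⟩, trivial⟩
  obtain ⟨b', h3, h4⟩ := hdense a m hm1
  exact hm ⟨b', h3, htrans _ _ _ h4 hm2⟩ trivial h4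

section Topological

variable [TopologicalSpace S]

/-- The loop of x on [0, T] can be glued to itself any finite number of times, and closedness gives
the bi-infinite repetition. -/
lemma IsMarkov.exists_periodic (hX : IsMarkov X) {x : ℤ → S} (hx : x ∈ X) {T : ℤ} (hT : 0 < T)
    (hxT : x T = x 0) :
    ∃ p ∈ X, Function.Periodic p T ∧ ∀ j, 0 ≤ j → j ≤ T → p j = x j := by
  have hp : Function.Periodic (fun j : ℤ => x (j % T)) T := fun j => by simp
  have hpT : ∀ j, 0 ≤ j → j ≤ T → x (j % T) = x j := by
    intro j h0 h1
    rcases h1.lt_or_eq with h1 | rfl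
    · rw [Int.emod_eq_of_lt h0 h1]
    · simp [hxT]
  have hfin : ∀ n : ℕ, ∃ z ∈ X, ∀ j : ℤ, 0 ≤ j → j ≤ n * T → z j = x (j % T) := by
    intro n
    induction n with
    | zero =>
      refine ⟨x, hx, fun j h0 h1 => ?_⟩
      obtain rfl : j = 0 := by simp at h1; omega
      simp
    | succ n ih =>
      obtain ⟨z, hz, hzp⟩ := ih
      have hn : 0 ≤ (n : ℤ) * T := by positivity
      obtain ⟨u, hu, h1, h2⟩ := hX.glue z hz _ (hX.shift_mem x hx (-(n * T))) (n * T) (by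
        rw [hzp _ hn le_rfl]; simp)
      refine ⟨u, hu, fun j h0 hj => ?_⟩
      rcases le_total j (n * T) with h | h
      · rw [h1 j h, hzp j h0 h]
      · push_cast at hj
        rw [h2 j h, ← hpT (j + -(n * T)) (by linarith) (by linarith)]
        congr 1
        rw [← sub_eq_add_neg, Int.sub_mul_emod_self_right]
  refine ⟨_, mem_of_forall_exists_eqOn hX.isClosed fun n => ?_, hp, hpT⟩
  obtain ⟨z, hz, hzp⟩ := hfin (2 * n)
  refine ⟨_, hX.shift_mem z hz (n * T), fun j h0 h1 => ?_⟩
  have : (n : ℤ) ≤ n * T := le_mul_of_one_le_right (by positivity) hT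
  rw [hzp _ (by linarith) (by push_cast; linarith)]
  simp

/-- Every word of a configuration of `X` occurs in a periodic configuration. -/
lemma IsMarkov.exists_periodic_eqOn (hX : IsMarkov X) {x : ℤ → S} (hx : x ∈ X) (L n : ℕ) :
    ∃ p ∈ X, ∃ d : ℤ, n + L < d ∧ Function.Periodic p d ∧
      ∀ j : ℤ, -L ≤ j → j ≤ n → p j = x j := by
  -- Joining x to a later copy of itself makes the loop [0, d]: it starts with the word of x on [0,
  -- n] and ends with that on [-L, 0].
  obtain ⟨g, hg, d, hd1, hg1, hg2⟩ := hX.join_at hx hx n (-L)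
  have hgd : g d = x 0 := by simpa using hg2 0 (by omega)
  obtain ⟨p, hp, hper, hpg⟩ := hX.exists_periodic hg (T := d) (by omega)
    (by rw [hgd, hg1 0 (by omega)])
  refine ⟨p, hp, d, by omega, hper, fun j h1 h2 => ?_⟩
  rcases le_or_gt 0 j with h | h
  · rw [hpg j h (by omega), hg1 j h2]
  · rw [← hper j, hpg _ (by omega) (by omega), hg2 j h1]

variable [DiscreteTopology S] [Finite S]

/-- The symbols of a transition block of minimal depth are not redundant along a periodic
configuration. -/
lemma exists_reach_unique (hX : IsMarkov X) {L : ℕ} {M : Finset S} {k : ℤ}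
    (hy : ∀ l, y (l + k) = y l) (hLk : L ≤ k) (hM : IsTransitionBlock X φ y 0 L M)
    (hd : DepthAtLeast X φ M.card) (hne : (fiber X φ y).Nonempty) {a : S} (ha : a ∈ M) :
    ∃ s ∈ M, ∃ u ∈ M, Reach X φ y 0 k s a ∧ Reach X φ y 0 k a u ∧
      ∀ c ∈ M, Reach X φ y 0 k s c → Reach X φ y 0 k c u → c = a := by
  classical
  by_contra! hcon
  have hM1 : IsTransitionBlock X φ y k L M := by
    simpa using hM.shift hX k fun l _ _ => hy l
  have hy' : ∀ l, y (l + -k) = y l := fun l => by simpa using (hy (l + -k)).symm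
  have hM2 : IsTransitionBlock X φ y (-k) L M := by
    simpa using hM.shift hX (-k) fun l _ _ => hy' l
  -- Cut a point of the fiber at the blocks at -k, 0 and k, in symbols s, c, u. If a could always be
  -- replaced between s and u, then M without a would suffice at 0. The radius k + L covers all
  -- three windows.
  obtain ⟨L', hL'⟩ := exists_isTransitionBlock hX (y := y) (φ := φ) (t := 0)
    (M := M.erase a) fun x hx => by
      obtain ⟨l, hl⟩ : ∃ l : ℕ, (l : ℤ) = k + L := ⟨(k + L).toNat, by omega⟩
      refine ⟨l, ?_⟩
      rw [hl]
      obtain ⟨s, hs, h1, h2⟩ := hM2.exists_reach (i := 0 - (k + L)) (j := 0 + (k + L)) (by omega)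
        (by omega) (Reach.of_mem_fiber hx _ _)
      obtain ⟨u, hu, h3, h4⟩ := hM1.exists_reach (by omega) (by omega) h2
      obtain ⟨c, hc, h5, h6⟩ := hM.exists_reach (by omega) (by omega) h3
      by_cases hca : c = a
      · subst hca
        obtain ⟨b, hb, h7, h8, h9⟩ := hcon s hs u hu
          (by simpa using h5.shift hX k fun l _ _ => hy l) h6
        refine ⟨b, Finset.mem_erase.2 ⟨h9, hb⟩, h1.trans hX (by omega) (by omega) ?_,
          h8.trans hX (by omega) (by omega) h4⟩
        simpa using h7.shift hX (-k) fun l _ _ => hy' l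
      · exact ⟨c, Finset.mem_erase.2 ⟨hca, hc⟩, h1.trans hX (by omega) (by omega) h5,
          h6.trans hX (by omega) (by omega) h4⟩
  have := hd y 0 L' _ hne hL'
  have := Finset.card_erase_lt_of_mem ha
  omega

/-- Along a periodic configuration carrying a transition block of minimal depth, the paths between
the symbols of the block form a partial order, for a suitable multiple of the period. -/
lemma exists_reach_partialOrder (hX : IsMarkov X) {L : ℕ} {M : Finset S} {k : ℤ}
    (hy : Function.Periodic y k) (hk : 0 < k) (hLk : L ≤ k)
    (hM : IsTransitionBlock X φ y 0 L M)
    (hd : DepthAtLeast X φ M.card) (hne : (fiber X φ y).Nonempty) :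
    ∃ N : ℕ, 0 < N ∧ (∀ a ∈ M, Reach X φ y 0 (N * k) a a) ∧
      ∀ a ∈ M, ∀ b ∈ M, Reach X φ y 0 (N * k) a b → Reach X φ y 0 (N * k) b a → a = b := by
  have hyn : ∀ (n : ℕ) l, y (l + n * k) = y l := fun n l => by
    simpa using hy.int_mul n l
  have hMn : ∀ n : ℕ, IsTransitionBlock X φ y (n * k) L M := fun n => by
    simpa using hM.shift hX (n * k) fun l _ _ => hyn n l
  have hle : ∀ n : ℕ, 0 < n → k ≤ n * k := fun n hn =>
    le_mul_of_one_le_left hk.le (by exact_mod_cast hn)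
  -- The block at each multiple of k lets paths be cut there in M, so the reachability relations on
  -- M compose like powers of one relation.
  have hcomp : ∀ m n : ℕ, 0 < m → 0 < n → ∀ a b, Reach X φ y 0 ((m + n : ℕ) * k) a b ↔
      ∃ c ∈ M, Reach X φ y 0 (m * k) a c ∧ Reach X φ y 0 (n * k) c b := by
    intro m n hm hn a b
    have h1 := hle m hm
    have h2 := hle n hn
    have h3 : ((m + n : ℕ) : ℤ) * k = n * k + m * k := by push_cast; ring
    have hsub : ∀ l, y (l + -(m * k)) = y l := fun l => by simpa using (hyn m (l + -(m * k))).symm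
    rw [h3]
    constructor
    · intro h
      obtain ⟨c, hc, h4, h5⟩ := (hMn m).exists_reach (by linarith) (by linarith) h
      exact ⟨c, hc, h4, by simpa using h5.shift hX (-(m * k)) fun l _ _ => hsub l⟩
    · rintro ⟨c, hc, h4, h5⟩
      have h6 := h5.shift hX (m * k) (y' := y) fun l _ _ => hyn m l
      rw [zero_add] at h6
      exact h4.trans hX (by linarith) (by linarith) h6
  -- A finite set carries finitely many relations, so the powers are eventually periodic. Exponents
  -- are offset by one since `hcomp` needs positive ones.
  obtain ⟨i, j, hij, heq⟩ : ∃ i j : ℕ, i < j ∧ ∀ a ∈ M, ∀ b ∈ M,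
      Reach X φ y 0 ((i + 1 : ℕ) * k) a b ↔ Reach X φ y 0 ((j + 1 : ℕ) * k) a b := by
    obtain ⟨i, j, hij, h⟩ := Finite.exists_ne_map_eq_of_infinite
      fun (n : ℕ) (a b : M) => Reach X φ y 0 ((n + 1 : ℕ) * k) a b
    have h' : ∀ a ∈ M, ∀ b ∈ M,
      Reach X φ y 0 ((i + 1 : ℕ) * k) a b ↔ Reach X φ y 0 ((j + 1 : ℕ) * k) a b :=
      fun a ha b hb => iff_of_eq (congrFun (congrFun h ⟨a, ha⟩) ⟨b, hb⟩)
    rcases hij.lt_or_gt with hij | hij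
    · exact ⟨i, j, hij, h'⟩
    · exact ⟨j, i, hij, fun a ha b hb => (h' a ha b hb).symm⟩
  have hper : ∀ n, i + 1 ≤ n → ∀ a ∈ M, ∀ b ∈ M,
      Reach X φ y 0 (n * k) a b ↔ Reach X φ y 0 ((n + (j - i) : ℕ) * k) a b := by
    intro n hn a ha b hb
    rcases hn.eq_or_lt with rfl | hn
    · rw [heq a ha b hb, show i + 1 + (j - i) = j + 1 by omega]
    · obtain ⟨r, rfl⟩ := Nat.exists_eq_add_of_le hn.le
      rw [hcomp (i + 1) r (by omega) (by omega),
        show i + 1 + r + (j - i) = j + 1 + r by omega, hcomp (j + 1) r (by omega) (by omega)]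
      exact exists_congr fun c => and_congr_right fun hc => and_congr_left fun _ => heq a ha c hc
  have hper' : ∀ s n, i + 1 ≤ n → ∀ a ∈ M, ∀ b ∈ M,
      Reach X φ y 0 (n * k) a b ↔ Reach X φ y 0 ((n + s * (j - i) : ℕ) * k) a b := by
    intro s
    induction s with
    | zero => simp
    | succ s ih =>
      intro n hn a ha b hb
      rw [ih n hn a ha b hb, hper _ (by omega) a ha b hb]
      ring_nf
  obtain ⟨t, ht⟩ : ∃ t, t = j - i := ⟨_, rfl⟩
  rw [← ht] at hper'
  have hN : i + 1 ≤ (i + 1) * t := Nat.le_mul_of_pos_right _ (by omega)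
  -- N is a multiple of the period of the powers and lies in their periodic range, so the N-th power
  -- is idempotent.
  generalize hNe : (i + 1) * t = N at hN
  have hidem : ∀ a ∈ M, ∀ b ∈ M, Reach X φ y 0 (N * k) a b ↔
      ∃ c ∈ M, Reach X φ y 0 (N * k) a c ∧ Reach X φ y 0 (N * k) c b := by
    intro a ha b hb
    have := hper' (i + 1) N hN a ha b hb
    rw [hNe] at this
    rw [this, hcomp N N (by omega) (by omega)]
  have huniq := fun a ha => exists_reach_unique hX (k := N * k) (a := a) (hyn N)
    (hLk.trans (hle N (by omega))) hM hd hne ha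
  refine ⟨N, by omega, fun a ha => ?_, fun a ha b hb hab hba => ?_⟩
  · obtain ⟨s, hs, u, hu, h1, h2, h3⟩ := huniq a ha
    -- An idempotent relation is transitive and dense, so some reflexive symbol lies between s and
    -- u; by uniqueness it is a. For antisymmetry, b also lies between s and u when a and b reach
    -- each other.
    obtain ⟨⟨c, hc⟩, h4, h5, h6⟩ := exists_refl_between
      (e := fun a b : M => Reach X φ y 0 (N * k) a b)
      (fun a b c h h' => (hidem a a.2 c c.2).2 ⟨b, b.2, h, h'⟩)
      (fun a c h => by
        obtain ⟨b, hb, h⟩ := (hidem a a.2 c c.2).1 h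
        exact ⟨⟨b, hb⟩, h⟩)
      (a := ⟨s, hs⟩) (c := ⟨u, hu⟩) ((hidem s hs u hu).2 ⟨a, ha, h1, h2⟩)
    obtain rfl := h3 c hc h4 h6
    exact h5
  · obtain ⟨s, hs, u, hu, h1, h2, h3⟩ := huniq a ha
    exact (h3 b hb ((hidem s hs b hb).2 ⟨a, ha, h1, hab⟩)
      ((hidem b hb u hu).2 ⟨a, ha, hba, h2⟩)).symm

/-- Paths with the same image starting from distinct symbols of a transition block of minimal
depth never merge. -/
lemma eq_of_merge (hX : IsMarkov X) {L : ℕ} {M : Finset S} (hd : DepthAtLeast X φ M.card)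
    {z z' : ℤ → S} (hz : z ∈ X) (hz' : z' ∈ X)
    (hM : IsTransitionBlock X φ (fun l => φ (z l)) 0 L M) {n : ℤ} (hn : L ≤ n)
    (hzz' : ∀ l, 0 ≤ l → l ≤ n → φ (z' l) = φ (z l)) (h0 : z 0 ∈ M) (h0' : z' 0 ∈ M)
    (hzn : z n = z' n) : z 0 = z' 0 := by
  obtain ⟨n, rfl⟩ : ∃ n' : ℕ, n = n' := ⟨n.toNat, by omega⟩
  obtain ⟨p, hp, d, hd1, hper, hpz⟩ := hX.exists_periodic_eqOn hz L n
  have hpf : p ∈ fiber X φ (fun l => φ (p l)) := ⟨hp, fun _ => rfl⟩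
  have hpn : ∀ l : ℤ, 0 ≤ l → l ≤ n → p l = z l := fun l h h' => hpz l (by omega) h'
  have hMp : IsTransitionBlock X φ (fun l => φ (p l)) 0 L M := hM.congr fun l hl hl' => by
    simp only [hpz l (by omega) (by omega)]
  have hp0 : p 0 = z 0 := hpn 0 le_rfl (by omega)
  obtain ⟨N, hN, hrefl, -⟩ := exists_reach_partialOrder hX (y := fun l => φ (p l)) (k := d)
    (fun l => by simp only [hper l]) (by omega) (by omega) hMp hd ⟨p, hpf⟩
  have hdN : d ≤ N * d := le_mul_of_one_le_left (by omega) (by exact_mod_cast hN)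
  have hNd : p (N * d) = z 0 := by
    rw [← hp0, ← hper.int_mul N 0]
    simp
  have hyN : ∀ l, φ (p (l + N * d)) = φ (p l) := fun l => by
    have := hper.int_mul N l
    simp only [Int.cast_id] at this
    rw [this]
  generalize (N : ℤ) * d = K at hrefl hdN hNd hyN
  -- Follow z' up to the merging at n, then p up to K, where p is back at `z 0`.
  have hba : Reach X φ (fun l => φ (p l)) 0 K (z' 0) (z 0) := by
    have h1 : Reach X φ (fun l => φ (p l)) 0 n (z' 0) (p n) :=
      ⟨z', hz', fun l h h' => by simp only [hzz' l h h', hpn l h h'], rfl, by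
        rw [hpn n (by omega) le_rfl, hzn]⟩
    have h2 := h1.trans hX (by omega) (by omega) (Reach.of_mem_fiber hpf n K)
    rwa [hNd] at h2
  obtain ⟨v, hv, hv1, hv2, hv3⟩ := hba
  -- With a = `z 0` and b = `z' 0`, the loop q runs along p from a to a, along a connecting word
  -- from a to b, and along v from b to a. Its image shows the word of p on [0, K] twice, so either
  -- copy can be exchanged for another path over that word.
  obtain ⟨h, hh, D, hD, hh1, hh2⟩ := hX.join_at hp hv K 0
  have hhT : h (K + D) = z 0 := by rw [hh2 K (by omega), hv3]
  obtain ⟨q, hq, hqper, hqh⟩ := hX.exists_periodic hh (T := K + D) (by omega)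
    (by rw [hhT, hh1 0 (by omega), hp0])
  have hqf : q ∈ fiber X φ (fun l => φ (q l)) := ⟨hq, fun _ => rfl⟩
  have hqK : ∀ l, 0 ≤ l → l ≤ K → q l = p l := fun l h h' => by
    rw [hqh l h (by omega), hh1 l h']
  have hqD : ∀ l, 0 ≤ l → l ≤ K → q (l + D) = v l := fun l h h' => by
    rw [hqh _ (by omega) (by omega), hh2 l h]
  have hMq : IsTransitionBlock X φ (fun l => φ (q l)) 0 L M := hMp.congr fun l hl hl' => by
    rcases le_or_gt 0 l with h | h
    · simp only [hqK l h (by omega)]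
    · rw [← hqper l, ← add_assoc, hqD _ (by omega) (by omega), hv1 _ (by omega) (by omega)]
      exact hyN l
  have hq0 : q 0 = z 0 := by rw [hqK 0 le_rfl (by omega), hp0]
  have hKD : Reach X φ (fun l => φ (q l)) K D (z 0) (z' 0) := by
    have h1 := Reach.of_mem_fiber hqf K D
    have h2 := hqD 0 le_rfl (by omega)
    rw [zero_add, hv2] at h2
    rwa [h2, hqK K (by omega) le_rfl, hNd] at h1
  have hshift : ∀ {s t}, Reach X φ (fun l => φ (p l)) 0 K s t →
      Reach X φ (fun l => φ (q l)) D (K + D) s t := fun {s t} h => by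
    have := h.shift hX D (y' := fun l => φ (q l)) fun l h h' => by
      simp only [hqD l h h', hv1 l h h']
    rwa [zero_add] at this
  have h0K : ∀ {s t}, Reach X φ (fun l => φ (p l)) 0 K s t →
      Reach X φ (fun l => φ (q l)) 0 K s t := fun {s t} h =>
    h.congr fun l h h' => by simp only [hqK l h h']
  -- Over one period of q: a to a, a to b, b to b by reflexivity, and in `hba'` b to a, a to b, b to
  -- a using v twice.
  have hab' : Reach X φ (fun l => φ (q l)) 0 (K + D) (z 0) (z' 0) :=
    (h0K (hrefl _ h0)).trans hX (by omega) (by omega)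
      (hKD.trans hX (by omega) (by omega) (hshift (hrefl _ h0')))
  have hba' : Reach X φ (fun l => φ (q l)) 0 (K + D) (z' 0) (z 0) :=
    (h0K ⟨v, hv, hv1, hv2, hv3⟩).trans hX (by omega) (by omega)
      (hKD.trans hX (by omega) (by omega) (hshift ⟨v, hv, hv1, hv2, hv3⟩))
  obtain ⟨N', hN', -, hanti⟩ := exists_reach_partialOrder hX (y := fun l => φ (q l)) (k := K + D)
    (fun l => by simp only [hqper l]) (by omega) (by omega) hMq hd ⟨q, hqf⟩
  obtain ⟨m, rfl⟩ := Nat.exists_eq_add_of_le' hN'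
  push_cast at hanti
  have hT : 0 < K + D := by omega
  generalize K + D = T at *
  have hmT : 0 ≤ (m : ℤ) * T := by positivity
  have hqm : ∀ (m : ℕ) l, q (l + m * T) = q l := fun m l => by
    simpa using hqper.int_mul m l
  have hend : q ((m + 1) * T) = z 0 := by simpa [hq0] using hqm (m + 1) 0
  have hmid : q (m * T) = z 0 := by simpa [hq0] using hqm m 0
  have hqT : q T = z 0 := by simpa [hq0] using hqper 0
  have hmul : ((m : ℤ) + 1) * T = T + m * T := by ring
  -- The order is that of m + 1 periods; the m spare periods are spent on q itself, which returns to
  -- a.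
  refine hanti _ h0 _ h0' ?_ ?_
  · have h1 := Reach.of_mem_fiber hqf 0 (m * T)
    rw [hq0, hmid] at h1
    have h2 := hab'.shift hX (m * T) (y' := fun l => φ (q l)) fun l _ _ => by simp only [hqm]
    rw [zero_add] at h2
    rw [hmul]
    exact h1.trans hX hmT (by omega) h2
  · have h1 := Reach.of_mem_fiber hqf T ((m + 1) * T)
    rw [hqT, hend] at h1
    exact hba'.trans hX hT.le (by rw [hmul]; omega) h1

end Topological

end ClassDegree

/-! ### Class-closing: closedness of class counts, and extra classes when it fails -/

namespace ClassDegree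

variable {S B : Type*} {X : Set (ℤ → S)} {φ : S → B} {y y' : ℤ → B}

/-- Left asymptotic points of a fiber are right equivalent. -/
def IsClosing (X : Set (ℤ → S)) (φ : S → B) : Prop :=
  ∀ y, ∀ x ∈ fiber X φ y, ∀ x' ∈ fiber X φ y, (∃ n, ∀ l ≤ n, x l = x' l) →
    TransEquiv X φ y x x'

section Topological

variable [TopologicalSpace S]

/-- Transitions depend only on right tails, up to a shift by d: an earlier start can follow x until
the tail begins. -/
lemma Trans.of_tail (hX : IsMarkov X) {x x' z z' : ℤ → S} (hx : x ∈ fiber X φ y)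
    (hx' : x' ∈ fiber X φ y) {N d : ℤ} (hy : ∀ l, N ≤ l → y' (l + d) = y l)
    (hz : ∀ l, N ≤ l → z (l + d) = x l) (hz' : ∀ l, N ≤ l → z' (l + d) = x' l)
    (h : Trans X φ y' z z') : Trans X φ y x x' := by
  intro m
  obtain ⟨n, hn, h1⟩ := h (max m N + d)
  have hm := le_max_left m N
  have hN := le_max_right m N
  generalize max m N = m' at *
  have h2 := h1.shift hX (-d) (y' := y) fun l hl _ => by
    rw [← hy _ (by omega)]
    simp
  have h3 : z' n = x' (n + -d) := by rw [← hz' _ (by omega)]; simp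
  rw [hz m' hN, h3, show m' + d + -d = m' by ring] at h2
  exact ⟨n + -d, by omega, h2.mono hX hx hx' (by omega) hm le_rfl⟩

lemma TransEquiv.of_tail (hX : IsMarkov X) {x x' z z' : ℤ → S} (hx : x ∈ fiber X φ y)
    (hx' : x' ∈ fiber X φ y) {N d : ℤ} (hy : ∀ l, N ≤ l → y' (l + d) = y l)
    (hz : ∀ l, N ≤ l → z (l + d) = x l) (hz' : ∀ l, N ≤ l → z' (l + d) = x' l)
    (h : TransEquiv X φ y' z z') : TransEquiv X φ y x x' :=
  ⟨h.1.of_tail hX hx hx' hy hz hz', h.2.of_tail hX hx' hx hy hz' hz⟩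

lemma HasClasses.shift (hX : IsMarkov X) {k : ℕ} (h : HasClasses X φ k y) (d : ℤ) :
    HasClasses X φ k (fun l => y (l + d)) := by
  obtain ⟨f, hf, hne⟩ := h
  exact ⟨fun c l => f c (l + d), fun c => ⟨hX.shift_mem _ (hf c).1 d, fun l => (hf c).2 _⟩,
    fun c c' hc hcc => hne c c' hc (hcc.of_tail hX (N := 0) (d := -d) (hf c) (hf c')
      (by simp) (by simp) (by simp))⟩

/-- The bridge is left asymptotic to x, hence right equivalent to it by closing, and eventually
equal to x'. A single one-way path thus forces equivalence. -/
lemma IsClosing.transEquiv (hX : IsMarkov X) (h : IsClosing X φ) {x x' : ℤ → S}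
    (hx : x ∈ fiber X φ y) (hx' : x' ∈ fiber X φ y) {i j : ℤ} (hij : i ≤ j)
    (hr : Reach X φ y i j (x i) (x' j)) : TransEquiv X φ y x x' := by
  obtain ⟨z, hz, h1, h2⟩ := hr.exists_mem_fiber hX hx hx' hij
  exact (h y x hx z hz ⟨i, fun l hl => (h1 l hl).symm⟩).trans hX (.of_eventually_eq hz hx' h2)

variable [DiscreteTopology S] [Finite S]

/-- If left asymptotic points of a fiber are right equivalent, then having at least `k` right
classes is a closed condition. -/
lemma IsClosing.isClosed_hasClasses [TopologicalSpace B] [DiscreteTopology B] (hX : IsMarkov X)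
    (h : IsClosing X φ) (k : ℕ) : IsClosed {y | HasClasses X φ k y} := by
  rw [← isSeqClosed_iff_isClosed]
  intro u y hu hy
  let C : ℕ → Set (Fin k → ℤ → S) := fun n =>
    {f | ∀ c, f c ∈ X ∩ {x | ∀ l, -(n : ℤ) ≤ l → l ≤ n → φ (x l) = y l}} ∩
      {f | ∀ c c', c ≠ c' → ∀ i j : ℤ, -n ≤ i → i ≤ j → j ≤ n → ¬ Reach X φ y i j (f c i) (f c' j)}
  have hanti : ∀ n, C (n + 1) ⊆ C n := by
    rintro n f ⟨h1, h2⟩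
    exact ⟨fun c => ⟨(h1 c).1, fun l hl hl' => (h1 c).2 l (by omega) (by omega)⟩,
      fun c c' hc i j hi hij hj => h2 c c' hc i j (by omega) hij (by omega)⟩
  have hne : ∀ n, (C n).Nonempty := by
    intro n
    have hev : ∀ᶠ m in Filter.atTop, ∀ l ∈ Finset.Icc (-(n : ℤ)) n, u m l = y l := by
      rw [Filter.eventually_all_finset]
      intro l _
      have := (tendsto_pi_nhds.1 hy l)
      rw [nhds_discrete, Filter.tendsto_pure] at this
      exact this
    obtain ⟨m, hm⟩ := hev.exists
    simp only [Finset.mem_Icc, and_imp] at hm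
    obtain ⟨f, hf, hff⟩ := hu m
    exact ⟨f, fun c => ⟨(hf c).1, fun l hl hl' => ((hf c).2 l).trans (hm l hl hl')⟩,
      fun c c' hc i j hi hij hj hr => hff c c' hc (h.transEquiv hX (hf c) (hf c') hij
        (hr.congr fun l hl hl' => (hm l (by omega) (by omega)).symm))⟩
  have hcl : ∀ n, IsClosed (C n) := by
    intro n
    refine IsClosed.inter ?_ ?_
    · rw [Set.ofPred_forall]
      exact isClosed_iInter fun c =>
        (hX.isClosed.inter (isClosed_setOf_over φ y _ _)).preimage (continuous_apply c)
    · simp only [Set.ofPred_forall]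
      refine isClosed_iInter fun c => isClosed_iInter fun c' => isClosed_iInter fun _ =>
        isClosed_iInter fun i => isClosed_iInter fun j => isClosed_iInter fun _ =>
        isClosed_iInter fun _ => isClosed_iInter fun _ => ?_
      have hcont : Continuous fun f : Fin k → ℤ → S => (f c i, f c' j) := by fun_prop
      exact (isClosed_discrete {s : S × S | ¬ Reach X φ y i j s.1 s.2}).preimage hcont
  obtain ⟨f, hf⟩ := exists_forall_mem_of_antitone C hanti hne hcl
  refine ⟨f, fun c => ⟨((hf 0).1 c).1, fun l =>
    ((hf l.natAbs).1 c).2 l (by omega) (by omega)⟩, fun c c' hc hcc => ?_⟩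
  obtain ⟨n, hn, hr⟩ := hcc.1 0
  exact (hf n.toNat).2 c c' hc 0 n (by omega) hn (by omega) hr

omit [DiscreteTopology S] in
/-- There are a periodic configuration and a word of its image making a transition block of
minimal depth. -/
lemma exists_periodic_minimal (hX : IsMarkov X) (hne : X.Nonempty) (φ : S → B) :
    ∃ p ∈ X, ∃ k : ℤ, 0 < k ∧ Function.Periodic p k ∧ ∃ L M,
      IsTransitionBlock X φ (fun l => φ (p l)) 0 L M ∧ DepthAtLeast X φ M.card := by
  classical
  have := Fintype.ofFinite S
  obtain ⟨x₀, hx₀⟩ := hne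
  have hex : ∃ n, ∃ y t L M, (fiber X φ y).Nonempty ∧ IsTransitionBlock X φ y t L M ∧
      M.card = n :=
    ⟨_, fun l => φ (x₀ l), 0, 0, Finset.univ, ⟨x₀, hx₀, fun _ => rfl⟩,
      fun x hx _ => ⟨x, hx, fun _ => rfl, fun _ _ => rfl, fun _ _ => rfl, Finset.mem_univ _⟩, rfl⟩
  obtain ⟨y, t, L, M, ⟨x, hx⟩, hM, hcard⟩ := Nat.find_spec hex
  obtain ⟨p, hp, k, hk, hper, hpx⟩ := hX.exists_periodic_eqOn (hX.shift_mem x hx.1 t) L L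
  refine ⟨p, hp, k, by omega, hper, L, M, ?_, fun y' t' L' M' hne' hM' => ?_⟩
  · have := hM.shift hX (-t) (y' := fun l => φ (p l)) fun l hl hl' => by
      simp only [hpx (l + -t) (by omega) (by omega), ← hx.2]
      simp
    rwa [add_neg_cancel] at this
  · rw [hcard]
    exact Nat.find_min' hex ⟨y', t', L', M', hne', hM', rfl⟩

/-- Points of a fiber through distinct symbols of a transition block of minimal depth admit no
transition. -/
lemma IsTransitionBlock.eq_of_reach (hX : IsMarkov X) {L : ℕ} {M : Finset S}
    (hd : DepthAtLeast X φ M.card) {t : ℤ} (hM : IsTransitionBlock X φ y t L M) {x x' : ℤ → S}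
    (hx : x ∈ fiber X φ y) (hx' : x' ∈ fiber X φ y) (h : x t ∈ M) (h' : x' t ∈ M) {n : ℤ}
    (hn : t ≤ n) (hr : Reach X φ y t n (x t) (x' n)) : x t = x' t := by
  obtain ⟨z, hz, h1, h2, h3⟩ := hr.mono hX hx hx' hn le_rfl (le_max_left n (t + L))
  have hmax := le_max_right n (t + L)
  generalize max n (t + L) = N at *
  -- The path from `x t` was prolonged along x' to N ≥ t + L, so that it merges with x' beyond the
  -- window.
  have := eq_of_merge hX hd (hX.shift_mem x' hx'.1 t) (hX.shift_mem z hz t) (n := N - t) (L := L)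
    (by
      have := hM.shift hX (-t) (y' := fun l => φ (x' (l + t))) fun l _ _ => by
        simp [hx'.2]
      rwa [add_neg_cancel] at this) (by omega)
    (fun l hl hl' => by rw [h1 _ (by omega) (by omega), hx'.2]) (by simpa) (by simpa [h2])
    (by simpa using h3.symm)
  simpa [h2] using this.symm

/-- If some left asymptotic points of a fiber are not right equivalent, then the left tail of the
image of a periodic configuration carrying a transition block of minimal depth can be continued
to a configuration with more right classes than this depth. -/
lemma exists_hasClasses_of_not_isClosing (hX : IsMarkov X) (h : ¬ IsClosing X φ) {p : ℤ → S}
    (hp : p ∈ X) {k : ℤ} (hk : 0 < k) (hper : Function.Periodic p k) {L : ℕ} {M : Finset S}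
    (hM : IsTransitionBlock X φ (fun l => φ (p l)) 0 L M) (hd : DepthAtLeast X φ M.card) :
    ∃ y, HasClasses X φ (M.card + 1) y ∧ ∀ l ≤ 0, y l = φ (p l) := by
  classical
  simp only [IsClosing, not_forall] at h
  obtain ⟨y₀, x, hx, x', hx', ⟨n, hn⟩, hne⟩ := h
  -- z and z' keep the right tails of x and x', hence their inequivalence, and share the left tail
  -- of p.
  obtain ⟨z, hz, d, hd0, hzp, hzx⟩ := hX.join_at hp hx.1 0 n
  obtain ⟨z', hz', h1, h2⟩ := hX.glue z hz _ (hX.shift_mem x' hx'.1 (-d)) (n + d) (by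
    rw [hzx n le_rfl, hn n le_rfl]; simp)
  obtain ⟨y, hy⟩ : ∃ y : ℤ → B, y = fun l => φ (z l) := ⟨_, rfl⟩
  have hzy : z ∈ fiber X φ y := ⟨hz, fun l => by rw [hy]⟩
  have hzy' : z' ∈ fiber X φ y := ⟨hz', fun l => by
    rcases le_total l (n + d) with hl | hl
    · rw [hy, h1 l hl]
    · rw [hy, h2 l hl, hx'.2, ← hx.2, ← hzx _ (by omega)]
      simp⟩
  have hyp : ∀ l ≤ 0, y l = φ (p l) := fun l hl => by rw [hy, ← hzp l hl]
  have hzz' : ¬ TransEquiv X φ y z z' := fun hcon => hne <|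
    hcon.of_tail hX hx hx' (N := n) (d := d) (fun l hl => by rw [hy, ← hx.2, ← hzx l hl])
      hzx (fun l hl => by rw [h2 _ (by omega)]; simp)
  refine ⟨y, ?_, hyp⟩
  -- A copy of the block whose window lies entirely in the tail copied from p.
  obtain ⟨t, ht⟩ : ∃ t : ℤ, t = -((L + 1 : ℕ) * k) := ⟨_, rfl⟩
  have htL : t + L < 0 := by
    have : ((L + 1 : ℕ) : ℤ) ≤ (L + 1 : ℕ) * k := le_mul_of_one_le_right (by positivity) hk
    push_cast at *
    linarith
  have hMt : IsTransitionBlock X φ y t L M := by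
    have := hM.shift hX t (y' := y) fun l _ _ => by
      have h3 := hper.int_mul (-(L + 1 : ℕ)) l
      rw [hyp _ (by omega), ht, ← neg_mul]
      simpa using congrArg φ h3
    rwa [zero_add] at this
  obtain ⟨w, hw, -, hwz, hwM⟩ := hMt.exists_mem_fiber hzy
  -- w and w' are inequivalent like z and z', yet pass through the same symbol of M at t. One point
  -- for each other symbol completes M.card + 1 classes.
  obtain ⟨w', hw', hww, hwz'⟩ := hX.glue w hw.1 z' hz' (t + L) (by
    rw [hwz _ le_rfl, h1 _ (by omega)])
  have hwf' : w' ∈ fiber X φ y := ⟨hw', fun l => by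
    rcases le_total l (t + L) with hl | hl
    · rw [hww l hl, hw.2]
    · rw [hwz' l hl, hzy'.2]⟩
  have hwt : w' t = w t := hww t (by omega)
  have hwne : ¬ TransEquiv X φ y w' w := fun hcon => hzz' <|
    ((TransEquiv.of_eventually_eq hzy hw fun l hl => (hwz l hl).symm).trans hX hcon.symm).trans hX
      (.of_eventually_eq hwf' hzy' hwz')
  have hg : ∀ m : M, ∃ x ∈ fiber X φ y, x t = m := fun m =>
    hMt.exists_apply_eq hX hd ⟨z, hzy⟩ m.2
  choose g hgf hgt using hg
  have hsep : ∀ u ∈ fiber X φ y, ∀ v ∈ fiber X φ y, u t ∈ M → v t ∈ M → u t ≠ v t →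
      ¬ TransEquiv X φ y u v := fun u hu v hv hum hvm huv hcon => by
    obtain ⟨n, hn, hr⟩ := hcon.1 t
    exact huv (hMt.eq_of_reach hX hd hu hv hum hvm hn hr)
  have key : ∀ m : M, ∃ x ∈ fiber X φ y, x t = m ∧ ((m : S) = w t → x = w) := fun m => by
    by_cases hm : (m : S) = w t
    · exact ⟨w, hw, hm.symm, fun _ => rfl⟩
    · exact ⟨g m, hgf m, hgt m, fun h => absurd h hm⟩
  choose f hf hft hfw using key
  have hwf : ∀ m, ¬ TransEquiv X φ y w' (f m) := fun m => by
    by_cases hm : (m : S) = w t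
    · rw [hfw m hm]
      exact hwne
    · exact hsep _ hwf' _ (hf m) (by rwa [hwt]) (by rw [hft]; exact m.2)
        (by rw [hwt, hft]; exact Ne.symm hm)
  have hff : ∀ m m', m ≠ m' → ¬ TransEquiv X φ y (f m) (f m') := fun m m' hmm =>
    hsep _ (hf m) _ (hf m') (by rw [hft]; exact m.2) (by rw [hft]; exact m'.2)
      (by rw [hft, hft]; exact fun hcon => hmm (Subtype.ext hcon))
  refine HasClasses.of_fintype (ι := Option M) (by simp) (fun o => o.elim w' f) ?_ ?_
  · rintro (_ | m)
    exacts [hwf', hf m]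
  · rintro (_ | m) (_ | m') hmm
    · exact absurd rfl hmm
    · exact hwf m'
    · exact fun hcon => hwf m hcon.symm
    · exact hff m m' fun hcon => hmm (by rw [hcon])

end Topological

end ClassDegree

/-! ### Time reversal and the theorem for one-block maps -/

namespace ClassDegree

variable {S B : Type*} {X : Set (ℤ → S)} {φ : S → B} {y y' : ℤ → B}

/-- The configuration read backwards. -/
def rev {T : Type*} (x : ℤ → T) : ℤ → T := fun i => x (-i)

@[simp] lemma rev_apply {T : Type*} (x : ℤ → T) (i : ℤ) : rev x i = x (-i) := rfl

@[simp] lemma rev_rev {T : Type*} (x : ℤ → T) : rev (rev x) = x := by ext; simp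

@[simp] lemma rev_preimage_preimage {T : Type*} (X : Set (ℤ → T)) : rev ⁻¹' (rev ⁻¹' X) = X := by
  ext; simp

lemma periodic_rev {T : Type*} {p : ℤ → T} {k : ℤ} (h : Function.Periodic p k) :
    Function.Periodic (rev p) k := fun l => by
  rw [rev_apply, neg_add, ← sub_eq_add_neg, h.sub_eq, rev_apply]

lemma continuous_rev {T : Type*} [TopologicalSpace T] : Continuous (rev (T := T)) :=
  continuous_pi fun i => continuous_apply (-i)

lemma rev_mem_fiber {x : ℤ → S} (hx : x ∈ fiber X φ y) :
    rev x ∈ fiber (rev ⁻¹' X) φ (rev y) :=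
  ⟨by simpa using hx.1, fun l => hx.2 (-l)⟩

lemma rev_mem_fiber_of_rev {x : ℤ → S} (hx : x ∈ fiber (rev ⁻¹' X) φ (rev y)) :
    rev x ∈ fiber X φ y := by
  simpa using rev_mem_fiber hx

lemma Reach.rev {i j : ℤ} {s t : S} (h : Reach X φ y i j s t) :
    Reach (rev ⁻¹' X) φ (rev y) (-j) (-i) t s := by
  obtain ⟨z, hz, h1, rfl, rfl⟩ := h
  exact ⟨ClassDegree.rev z, by simpa using hz, fun l hl hl' => h1 (-l) (by omega) (by omega),
    by simp, by simp⟩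

lemma IsTransitionBlock.rev {t : ℤ} {L : ℕ} {M : Finset S}
    (h : IsTransitionBlock X φ y t L M) : IsTransitionBlock (rev ⁻¹' X) φ (rev y) (-t) L M := by
  intro x hx hxy
  obtain ⟨z, hz, h1, h2, h3, h4⟩ := h _ hx fun l hl hl' => by
    simpa using hxy (-l) (by omega) (by omega)
  exact ⟨ClassDegree.rev z, by simpa using hz, fun l => by simpa using h1 (-l),
    fun l hl => by simpa using h3 (-l) (by omega), fun l hl => by simpa using h2 (-l) (by omega),
    by simpa⟩

lemma IsTransitionBlock.rev_zero {p : ℤ → S} {L : ℕ} {M : Finset S}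
    (h : IsTransitionBlock X φ (fun l => φ (p l)) 0 L M) :
    IsTransitionBlock (ClassDegree.rev ⁻¹' X) φ (fun l => φ (ClassDegree.rev p l)) 0 L M := by
  have := h.rev
  rw [neg_zero] at this
  exact this

lemma DepthAtLeast.rev {d : ℕ} (h : DepthAtLeast X φ d) : DepthAtLeast (rev ⁻¹' X) φ d := by
  rintro y t L M ⟨x, hx⟩ hM
  exact h (ClassDegree.rev y) (-t) L M ⟨ClassDegree.rev x, by simpa using rev_mem_fiber hx⟩
    (by simpa using hM.rev)

section Topological

variable [TopologicalSpace S]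

lemma IsMarkov.rev (hX : IsMarkov X) : IsMarkov (rev ⁻¹' X) where
  isClosed := hX.isClosed.preimage continuous_rev
  shift_mem x hx k := by
    have := hX.shift_mem _ hx (-k)
    simp only [Set.mem_preimage] at this ⊢
    convert this using 2 with i
    simp only [rev_apply]
    congr 1
    ring
  glue x hx x' hx' i h := by
    obtain ⟨z, hz, h1, h2⟩ := hX.glue _ hx' _ hx (-i) (by simpa using h.symm)
    exact ⟨ClassDegree.rev z, by simpa using hz,
      fun j hj => by simpa using h2 (-j) (by omega), fun j hj => by simpa using h1 (-j) (by omega)⟩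
  join x hx x' hx' := by
    obtain ⟨z, hz, k, hk, h1, h2⟩ := hX.join _ hx' _ hx
    -- Reversal swaps the two ends of the join, so the origin moves to the start of the second
    -- point.
    refine ⟨fun i => z (-i + k), by
      have := hX.shift_mem z hz k
      have h3 : ClassDegree.rev (fun i => z (-i + k)) = fun i => z (i + k) := by ext; simp
      rwa [Set.mem_preimage, h3], k, hk,
      fun j hj => by simpa using h2 (-j) (by omega), fun j hj => ?_⟩
    have := h1 (-j) (by omega)
    simpa using this

/-- If the reversed system is closing then right equivalent points are left equivalent. -/
lemma IsClosing.hasClasses_of_rev (hX : IsMarkov X) (h : IsClosing (rev ⁻¹' X) φ) {k : ℕ}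
    (hk : HasClasses (rev ⁻¹' X) φ k (rev y)) : HasClasses X φ k y := by
  obtain ⟨f, hf, hne⟩ := hk
  refine ⟨fun c => rev (f c), fun c => rev_mem_fiber_of_rev (hf c), fun c c' hc hcc => ?_⟩
  obtain ⟨n, hn, hr⟩ := hcc.1 0
  have h1 := hr.rev
  exact hne c' c hc.symm (h.transEquiv hX.rev (hf c') (hf c) (i := -n) (j := -0) (by omega)
    (by simpa using h1))

/-- The block recurs at every large multiple of the period. -/
lemma not_hasClasses_of_periodic_tail (hX : IsMarkov X) {p : ℤ → S} {k : ℤ} (hk : 0 < k)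
    (hper : Function.Periodic p k) {L : ℕ} {M : Finset S}
    (hM : IsTransitionBlock X φ (fun l => φ (p l)) 0 L M) (hy : ∀ l, 0 ≤ l → y l = φ (p l)) :
    ¬ HasClasses X φ (M.card + 1) y := by
  refine not_hasClasses_of_recurrent (L := L) hX fun N => ?_
  obtain ⟨n, hn⟩ : ∃ n : ℕ, n = N.toNat + L := ⟨_, rfl⟩
  have hnk : (n : ℤ) ≤ n * k := le_mul_of_one_le_right (by positivity) hk
  refine ⟨n * k, by omega, ?_⟩
  have := hM.shift hX (n * k) (y' := y) fun l _ _ => by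
    have h3 := hper.int_mul n l
    rw [hy _ (by omega)]
    simpa using congrArg φ h3
  rwa [zero_add] at this

variable [DiscreteTopology S] [Finite S]

/-- Without closing, some y with an extra class has the left tail of the image of p. Moving it right
by multiples of k gives points of the set converging to that image, which has no extra class. -/
lemma isClosed_hasClasses_iff [TopologicalSpace B] [DiscreteTopology B] (hX : IsMarkov X)
    {p : ℤ → S} (hp : p ∈ X) {k : ℤ} (hk : 0 < k)
    (hper : Function.Periodic p k) {L : ℕ} {M : Finset S}
    (hM : IsTransitionBlock X φ (fun l => φ (p l)) 0 L M) (hd : DepthAtLeast X φ M.card) :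
    IsClosed {y | HasClasses X φ (M.card + 1) y} ↔ IsClosing X φ := by
  refine ⟨fun hcl => ?_, fun h => h.isClosed_hasClasses hX _⟩
  by_contra hcon
  obtain ⟨y, hy, hyp⟩ := exists_hasClasses_of_not_isClosing hX hcon hp hk hper hM hd
  refine not_hasClasses_of_periodic_tail hX hk hper hM (fun _ _ => rfl)
    (mem_of_forall_exists_eqOn hcl fun n => ⟨_, hy.shift hX (-(n * k)), fun j _ hj => ?_⟩)
  have hnk : (n : ℤ) ≤ n * k := le_mul_of_one_le_right (by positivity) hk
  have h3 := hper.int_mul (-n) j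
  rw [hyp _ (by omega), ← neg_mul]
  simpa using congrArg φ h3

/-- The extra right class comes from the right end, while left classes see only the periodic left
tail, where the minimal block recurs. -/
lemma exists_hasClasses_and_not_rev (hX : IsMarkov X) (h : ¬ IsClosing X φ)
    {p : ℤ → S} (hp : p ∈ X) {k : ℤ} (hk : 0 < k)
    (hper : Function.Periodic p k) {L : ℕ} {M : Finset S}
    (hM : IsTransitionBlock X φ (fun l => φ (p l)) 0 L M) (hd : DepthAtLeast X φ M.card) :
    ∃ y, HasClasses X φ (M.card + 1) y ∧ ¬ HasClasses (rev ⁻¹' X) φ (M.card + 1) (rev y) := by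
  obtain ⟨y, hy, hyp⟩ := exists_hasClasses_of_not_isClosing hX h hp hk hper hM hd
  exact ⟨y, hy, not_hasClasses_of_periodic_tail hX.rev hk (p := rev p)
    (periodic_rev hper) hM.rev_zero
    fun l hl => hyp (-l) (by omega)⟩

/-- The main theorem for one-block maps on Markov shifts. -/
theorem exists_classDegree [TopologicalSpace B] [DiscreteTopology B] (hX : IsMarkov X)
    (hne : X.Nonempty) (φ : S → B) : ∃ d : ℕ,
      (∀ y, (fiber X φ y).Nonempty → HasClasses X φ d y ∧ HasClasses (rev ⁻¹' X) φ d (rev y)) ∧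
      (∃ y, (fiber X φ y).Nonempty ∧ ¬ HasClasses X φ (d + 1) y) ∧
      (IsClosed {y | HasClasses X φ (d + 1) y} ↔ IsClosing X φ) ∧
      (IsClosed {y | HasClasses (rev ⁻¹' X) φ (d + 1) y} ↔ IsClosing (rev ⁻¹' X) φ) ∧
      ({y | HasClasses X φ (d + 1) y} = {y | HasClasses (rev ⁻¹' X) φ (d + 1) (rev y)} ↔
        IsClosing X φ ∧ IsClosing (rev ⁻¹' X) φ) := by
  obtain ⟨p, hp, k, hk, hper, L, M, hM, hd⟩ := exists_periodic_minimal hX hne φ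
  have hp' : rev p ∈ rev ⁻¹' X := by simpa
  have hper' : Function.Periodic (rev p) k := periodic_rev hper
  have hM' : IsTransitionBlock (rev ⁻¹' X) φ (fun l => φ (rev p l)) 0 L M := hM.rev_zero
  refine ⟨M.card, fun y hy => ⟨hd.hasClasses hX hy, hd.rev.hasClasses hX.rev ?_⟩,
    ⟨_, ⟨p, hp, fun _ => rfl⟩, not_hasClasses_of_periodic_tail hX hk hper hM fun _ _ => rfl⟩,
    isClosed_hasClasses_iff hX hp hk hper hM hd,
    isClosed_hasClasses_iff hX.rev hp' hk hper' hM' hd.rev, fun heq => ⟨?_, ?_⟩, fun ⟨h, h'⟩ => ?_⟩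
  · obtain ⟨x, hx⟩ := hy
    exact ⟨rev x, rev_mem_fiber hx⟩
  · by_contra hcon
    obtain ⟨y, hy, hy'⟩ := exists_hasClasses_and_not_rev hX hcon hp hk hper hM hd
    exact hy' (heq.subset hy)
  · by_contra hcon
    obtain ⟨y, hy, hy'⟩ := exists_hasClasses_and_not_rev hX.rev hcon hp' hk hper' hM' hd.rev
    rw [rev_preimage_preimage] at hy'
    exact hy' (heq.superset (show HasClasses (rev ⁻¹' X) φ (M.card + 1) (rev (rev y)) by simpa))
  · ext y
    refine ⟨fun hy => IsClosing.hasClasses_of_rev hX.rev ?_ ?_, fun hy => h'.hasClasses_of_rev hX hy⟩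
    · simpa using h
    · simpa using hy

end Topological

end ClassDegree

/-! ### From shifts of finite type to Markov shifts by higher block codes -/

namespace ClassDegree

section Words

variable {A : Type*}

/-- The word of `x` of length `n` at position `a`. -/
def word (x : ℤ → A) (a : ℤ) (n : ℕ) : List A := (List.range n).map fun j : ℕ => x (a + j)

@[simp] lemma length_word (x : ℤ → A) (a : ℤ) (n : ℕ) : (word x a n).length = n := by
  simp [word]

lemma word_getElem (x : ℤ → A) (a : ℤ) (n : ℕ) (i : ℕ) (h : i < (word x a n).length) :
    (word x a n)[i] = x (a + i) := by
  simp [word]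

lemma word_add (x : ℤ → A) (a : ℤ) (m n : ℕ) :
    word x a (m + n) = word x a m ++ word x (a + m) n := by
  simp [word, List.range_add, Function.comp_def, add_assoc]

lemma word_congr {x x' : ℤ → A} {a : ℤ} {n : ℕ} (h : ∀ l, a ≤ l → l < a + n → x l = x' l) :
    word x a n = word x' a n := by
  refine List.map_congr_left fun j hj => h _ (by omega) ?_
  have := List.mem_range.1 hj
  omega

variable [TopologicalSpace A] {X : Subshift A ℤ}

lemma inLanguage_word {x : ℤ → A} (hx : x ∈ X.carrier) (a : ℤ) (n : ℕ) :
    InLanguage X (word x a n) :=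
  ⟨x, hx, a, fun i h => (word_getElem x a n i h).symm⟩

lemma shift_mem {x : ℤ → A} (hx : x ∈ X.carrier) (k : ℤ) : (fun i => x (i + k)) ∈ X.carrier := by
  have := X.mapsTo k hx
  convert this using 2 with i
  simp [add_comm]

/-- A word of the language occurs at any given position of some point. -/
lemma InLanguage.exists_at {w : List A} (h : InLanguage X w) (a : ℤ) :
    ∃ x ∈ X.carrier, ∀ (i : ℕ) (h : i < w.length), x (a + i) = w[i] := by
  obtain ⟨x, hx, n, hn⟩ := h
  refine ⟨_, shift_mem hx (n - a), fun i hi => ?_⟩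
  rw [← hn i hi]
  congr 1
  ring

lemma InLanguage.exists_eqOn {G : ℤ → A} {a : ℤ} {n : ℕ} (h : InLanguage X (word G a n)) :
    ∃ x ∈ X.carrier, ∀ l, a ≤ l → l < a + n → x l = G l := by
  obtain ⟨x, hx, h1⟩ := h.exists_at a
  refine ⟨x, hx, fun l hl hl' => ?_⟩
  have := h1 (l - a).toNat (by rw [length_word]; omega)
  rwa [word_getElem, show a + ((l - a).toNat : ℤ) = l by omega] at this

/-- In a shift of finite type, points which agree on a long enough word can be glued along it. -/
lemma IsFiniteType.exists_glue (h : IsFiniteType X) : ∃ k : ℕ, ∀ R : ℕ, k ≤ 2 * R + 1 →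
    ∀ x ∈ X.carrier, ∀ x' ∈ X.carrier, ∀ i : ℤ, (∀ l, i - R ≤ l → l ≤ i + R → x l = x' l) →
      (fun l => if l ≤ i then x l else x' l) ∈ X.carrier := by
  obtain ⟨k, hk⟩ := h
  refine ⟨k, fun R hR x hx x' hx' i hxx' => mem_of_forall_exists_eqOn X.isClosed fun N => ?_⟩
  obtain ⟨G, hG⟩ : ∃ G : ℤ → A, ∀ l, G l = if l ≤ i then x l else x' l :=
    ⟨_, fun _ => rfl⟩
  -- The words of G used below overlap in the synchronizing word of length k at i - R, inside the
  -- zone of agreement since k ≤ 2 * R + 1. This n makes their union cover [-N, N].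
  obtain ⟨n, hn⟩ : ∃ n : ℕ, n = N + i.natAbs := ⟨_, rfl⟩
  have h1 : word G (i - R - n) (n + k) = word x (i - R - n) (n + k) := word_congr fun l _ hl => by
    rw [hG]
    split_ifs with hli
    · rfl
    · exact (hxx' l (by omega) (by push_cast at hl; omega)).symm
  have h2 : word G (i - R) (k + (n + 2 * R + 1)) = word x' (i - R) (k + (n + 2 * R + 1)) :=
    word_congr fun l hl _ => by
      rw [hG]
      split_ifs with hli
      · exact hxx' l (by omega) (by omega)
      · rfl
  have h3 := inLanguage_word hx (i - R - n) (n + k)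
  have h4 := inLanguage_word hx' (i - R) (k + (n + 2 * R + 1))
  have h5 := inLanguage_word hx (i - R) k
  have h6 : word G (i - R) k = word x (i - R) k := word_congr fun l hl hl' => by
    rw [hG]
    split_ifs with hli
    · rfl
    · exact (hxx' l (by omega) (by omega)).symm
  rw [← h1, word_add, sub_add_cancel] at h3
  rw [← h2, word_add] at h4
  rw [← h6] at h5
  have h7 := (hk _ (length_word _ _ _) h5).2 _ _ h3 h4
  rw [show word G (i - R) k = word G (i - R - n + n) k by rw [sub_add_cancel], ← word_add,
    show i - (R : ℤ) + k = i - R - n + (n + k : ℕ) by push_cast; ring, ← word_add] at h7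
  obtain ⟨z, hz, hzG⟩ := h7.exists_eqOn
  simp only [← hG]
  exact ⟨z, hz, fun j hj hj' => hzG j (by omega) (by push_cast; omega)⟩

lemma IsIrreducible.exists_join (h : IsIrreducible X) {R : ℕ}
    (hglue : ∀ x ∈ X.carrier, ∀ x' ∈ X.carrier, ∀ i : ℤ,
      (∀ l, i - R ≤ l → l ≤ i + R → x l = x' l) →
      (fun l => if l ≤ i then x l else x' l) ∈ X.carrier)
    {x x' : ℤ → A} (hx : x ∈ X.carrier) (hx' : x' ∈ X.carrier) :
    ∃ z ∈ X.carrier, ∃ k : ℤ, 0 < k ∧ (∀ l ≤ (R : ℤ), z l = x l) ∧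
      ∀ l, -(R : ℤ) ≤ l → z (l + k) = x' l := by
  obtain ⟨w, hw⟩ := h _ _ (inLanguage_word hx (-R) (2 * R + 1)) (inLanguage_word hx' (-R) (2 * R + 1))
  obtain ⟨g, hg, hgw⟩ := hw.exists_at (-R)
  -- The distance in g between the central words of x and x'; gluing takes place at 0 and at k.
  obtain ⟨k, hk⟩ : ∃ k : ℤ, k = 2 * R + 1 + w.length := ⟨_, rfl⟩
  have hg1 : ∀ l : ℤ, -R ≤ l → l ≤ R → x l = g l := fun l hl hl' => by
    have := hgw (l + R).toNat (by simp; omega)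
    rw [List.getElem_append_left (by simp; omega), List.getElem_append_left (by simp; omega),
      word_getElem, show -(R : ℤ) + (l + R).toNat = l by omega] at this
    exact this.symm
  have hg2 : ∀ l : ℤ, -R ≤ l → l ≤ R → g (l + k) = x' l := fun l hl hl' => by
    have := hgw (l + R + k).toNat (by simp; omega)
    rw [List.getElem_append_right (by simp; omega), word_getElem] at this
    simp only [List.length_append, length_word] at this
    rw [show -(R : ℤ) + (l + R + k).toNat = l + k by omega,
      show -(R : ℤ) + ((l + R + k).toNat - (2 * R + 1 + w.length) : ℕ) = l by omega] at this
    exact this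
  have h1 := hglue x hx g hg 0 fun l hl hl' => hg1 l (by omega) (by omega)
  have h2 := hglue _ h1 _ (shift_mem hx' (-k)) k fun l hl hl' => by
    rw [if_neg (by omega), ← hg2 (l + -k) (by omega) (by omega)]
    simp
  refine ⟨_, h2, k, by omega, fun l hl => ?_, fun l hl => ?_⟩
  · rw [if_pos (by omega)]
    split_ifs with h0
    · rfl
    · exact (hg1 l (by omega) hl).symm
  · split_ifs with h3 h4
    · omega
    · exact hg2 l hl (by omega)
    · simp

end Words

section Code

variable {A : Type*}

/-- The higher block code: the symbol at `i` is the word on `[i - R, i + R]`. -/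
def code (R : ℕ) (x : ℤ → A) : ℤ → Fin (2 * R + 1) → A := fun i j => x (i - R + (j : ℕ))

variable {R : ℕ} {x x' : ℤ → A}

lemma code_eq_iff {i j : ℤ} :
    code R x i = code R x' j ↔ ∀ l, -(R : ℤ) ≤ l → l ≤ R → x (i + l) = x' (j + l) := by
  constructor
  · intro h l hl hl'
    have := congrFun h ⟨(l + R).toNat, by omega⟩
    simp only [code] at this
    rwa [show i - R + ((l + R).toNat : ℤ) = i + l by omega,
      show j - R + ((l + R).toNat : ℤ) = j + l by omega] at this
  · intro h
    ext c
    have := h (-R + (c : ℕ)) (by omega) (by omega)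
    simp only [code]
    convert this using 2 <;> ring

lemma apply_eq_of_code_eq {i j : ℤ} (h : code R x i = code R x' j) : x i = x' j := by
  simpa using code_eq_iff.1 h 0 (by omega) (by omega)

lemma code_shift (k : ℤ) : code R (fun i => x (i + k)) = fun i => code R x (i + k) := by
  ext i j
  simp only [code]
  congr 1
  ring

lemma continuous_code [TopologicalSpace A] : Continuous (code (A := A) R) := by
  unfold code
  fun_prop

variable [TopologicalSpace A] [DiscreteTopology A] [Finite A] {X : Subshift A ℤ}

/-- One symbol of the code records 2 * R + 1 coordinates, enough to glue along. All large R are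
allowed so that the window of a factor code also fits. -/
lemma IsFiniteType.isMarkov_code (hfin : IsFiniteType X) (hirr : IsIrreducible X) :
    ∃ k : ℕ, ∀ R, k ≤ 2 * R + 1 → IsMarkov (code R '' X.carrier) := by
  obtain ⟨k, hk⟩ := hfin.exists_glue
  refine ⟨k, fun R hR => ⟨?_, ?_, ?_, ?_⟩⟩
  · exact (X.isClosed.isCompact.image continuous_code).isClosed
  · rintro _ ⟨x, hx, rfl⟩ k
    exact ⟨_, shift_mem hx k, code_shift k⟩
  · rintro _ ⟨x, hx, rfl⟩ _ ⟨x', hx', rfl⟩ i h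
    have h1 : ∀ l, i - R ≤ l → l ≤ i + R → x l = x' l := fun l hl hl' => by
      simpa using code_eq_iff.1 h (l - i) (by omega) (by omega)
    refine ⟨_, ⟨_, hk R hR x hx x' hx' i h1, rfl⟩, fun j hj => code_eq_iff.2 fun l hl hl' => ?_,
      fun j hj => code_eq_iff.2 fun l hl hl' => ?_⟩
    · split_ifs with h2
      · rfl
      · exact (h1 _ (by omega) (by omega)).symm
    · split_ifs with h2
      · exact h1 _ (by omega) (by omega)
      · rfl
  · rintro _ ⟨x, hx, rfl⟩ _ ⟨x', hx', rfl⟩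
    obtain ⟨z, hz, k, hk0, h1, h2⟩ := hirr.exists_join (hk R hR) hx hx'
    refine ⟨_, ⟨z, hz, rfl⟩, k, hk0, fun j hj => code_eq_iff.2 fun l hl hl' => h1 _ (by omega),
      fun j hj => code_eq_iff.2 fun l hl hl' => ?_⟩
    rw [← h2 (j + l) (by omega)]
    congr 1
    ring

end Code

end ClassDegree

/-! ### Transport of class counts and class-closing to the block presentation -/

namespace ClassDegree

lemma natCast_le_encard_image_iff {α β : Type*} (g : α → β) (F : Set α) (k : ℕ) :
    (k : ℕ∞) ≤ (g '' F).encard ↔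
      ∃ f : Fin k → α, (∀ c, f c ∈ F) ∧ ∀ c c', c ≠ c' → g (f c) ≠ g (f c') := by
  constructor
  · intro h
    obtain ⟨t, ht, hk⟩ := Set.exists_subset_encard_eq h
    have htf : t.Finite := Set.finite_of_encard_eq_coe hk
    have : Fintype t := htf.fintype
    have hcard : Fintype.card t = k := by
      rw [Set.encard_eq_coe_toFinset_card, Set.toFinset_card] at hk
      exact_mod_cast hk
    let e := Fintype.equivFinOfCardEq hcard
    choose f hf hfg using fun b : t => ht b.2
    refine ⟨fun c => f (e.symm c), fun c => hf _, fun c c' hc h => hc ?_⟩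
    rw [hfg, hfg] at h
    exact e.symm.injective (Subtype.ext h)
  · rintro ⟨f, hf, hne⟩
    have hinj : Function.Injective fun c => g (f c) := fun c c' h => by
      by_contra hc
      exact hne c c' hc h
    calc (k : ℕ∞) = ENat.card (Fin k) := by simp
      _ ≤ (Set.range fun c => g (f c)).encard := hinj.encard_range
      _ ≤ _ := Set.encard_le_encard (by
          rintro _ ⟨c, rfl⟩
          exact ⟨f c, hf c, rfl⟩)

variable {A B : Type*} [TopologicalSpace A] [TopologicalSpace B]
  {X : Subshift A ℤ} {Y : Subshift B ℤ}

namespace FactorCode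

variable (π : FactorCode X Y)

lemma map_shift_int (k : ℤ) (x : X.carrier) :
    (π.toFun ⟨SymbolicDynamics.FullShift.shift k x.1, X.mapsTo k x.2⟩).1 =
      SymbolicDynamics.FullShift.shift k (π.toFun x).1 := by
  have h1 : ∀ x : X.carrier,
      (π.toFun ⟨SymbolicDynamics.FullShift.shift 1 x.1, X.mapsTo 1 x.2⟩).1 =
        SymbolicDynamics.FullShift.shift 1 (π.toFun x).1 := fun x =>
    congrArg Subtype.val (π.map_shift x)
  induction k with
  | zero => simp
  | succ n ih =>
    have h2 := h1 ⟨SymbolicDynamics.FullShift.shift n x.1, X.mapsTo n x.2⟩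
    simp only [← shift_add] at h2
    rw [h2, ih, ← shift_add]
  | pred n ih =>
    have h2 := h1 ⟨SymbolicDynamics.FullShift.shift (-(n : ℤ) - 1) x.1, X.mapsTo _ x.2⟩
    simp only [← shift_add, sub_add_cancel] at h2
    rw [ih] at h2
    have h3 := congrArg (SymbolicDynamics.FullShift.shift (-1 : ℤ)) h2
    rw [← shift_add, ← shift_add] at h3
    simpa [sub_eq_add_neg] using h3.symm

variable [DiscreteTopology A] [Finite A] [DiscreteTopology B]

/-- A factor code depends on a finite window. -/
lemma exists_window : ∃ r : ℕ, ∀ x x' : X.carrier,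
    (∀ l : ℤ, -r ≤ l → l ≤ r → x.1 l = x'.1 l) → (π.toFun x).1 0 = (π.toFun x').1 0 := by
  by_contra! hcon
  have : CompactSpace X.carrier := isCompact_iff_compactSpace.1 X.isClosed.isCompact
  -- Pairs of points are written as functions on `Bool` to fit the compactness lemma for products; a
  -- limit pair would be equal with different images.
  let C : ℕ → Set (∀ _ : Bool, X.carrier) := fun n =>
    {f | ∀ l : ℤ, -n ≤ l → l ≤ n → (f true).1 l = (f false).1 l} ∩
      {f | (π.toFun (f true)).1 0 ≠ (π.toFun (f false)).1 0}
  have hanti : ∀ n, C (n + 1) ⊆ C n := fun n f hf =>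
    ⟨fun l hl hl' => hf.1 l (by push_cast; omega) (by push_cast; omega), hf.2⟩
  have hne : ∀ n, (C n).Nonempty := fun n => by
    obtain ⟨x, x', h1, h2⟩ := hcon n
    exact ⟨fun b => if b then x else x', by simpa using h1, by simpa using h2⟩
  have hcl : ∀ n, IsClosed (C n) := by
    intro n
    refine IsClosed.inter ?_ ?_
    · have h0 : ∀ b (l : ℤ), Continuous fun f : ∀ _ : Bool, X.carrier => (f b).1 l := fun b l =>
        (continuous_apply l).comp (continuous_subtype_val.comp (continuous_apply b))
      simp only [Set.ofPred_forall]
      exact isClosed_iInter fun l => isClosed_iInter fun _ => isClosed_iInter fun _ =>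
        isClosed_eq (h0 true l) (h0 false l)
    · have h0 : ∀ b, Continuous fun f : ∀ _ : Bool, X.carrier => (π.toFun (f b)).1 0 := fun b =>
        (continuous_apply 0).comp (continuous_subtype_val.comp
          (π.continuous_toFun.comp (continuous_apply b)))
      exact (isClosed_discrete {b : B × B | b.1 ≠ b.2}).preimage ((h0 true).prodMk (h0 false))
  obtain ⟨f, hf⟩ := exists_forall_mem_of_antitone C hanti hne hcl
  refine (hf 0).2 ?_
  rw [show f true = f false from Subtype.ext (funext fun l =>
    (hf l.natAbs).1 l (by omega) (by omega))]

/-- A factor code is a one-block map after passing to a higher block code. -/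
lemma exists_blockMap (hne : X.carrier.Nonempty) : ∃ r : ℕ, ∀ R, r ≤ R →
    ∃ φ : (Fin (2 * R + 1) → A) → B, ∀ (x : X.carrier) (i : ℤ),
      (π.toFun x).1 i = φ (code R x.1 i) := by
  obtain ⟨r, hr⟩ := π.exists_window
  obtain ⟨x₀, hx₀⟩ := hne
  -- A default value for φ on words outside the language.
  have : Nonempty B := ⟨(π.toFun ⟨x₀, hx₀⟩).1 0⟩
  refine ⟨r, fun R hR => ?_⟩
  obtain ⟨φ, hφ⟩ := (Function.factorsThrough_iff (f := fun x : X.carrier => code R x.1 0)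
    (fun x : X.carrier => (π.toFun x).1 0)).1 fun x x' h => hr x x' fun l hl hl' => by
      simpa using code_eq_iff.1 h l (by omega) (by omega)
  refine ⟨φ, fun x i => ?_⟩
  have h1 := congrFun (π.map_shift_int i x) 0
  have h2 := congrFun hφ ⟨SymbolicDynamics.FullShift.shift i x.1, X.mapsTo i x.2⟩
  simp only [Function.comp_apply] at h2
  rw [h1, shift_apply, add_zero] at h2
  rw [h2]
  congr 1
  exact code_eq_iff.2 fun l _ _ => by simp

end FactorCode

section Transport

variable {π : FactorCode X Y} {R : ℕ} {φ : (Fin (2 * R + 1) → A) → B}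

lemma code_mem_fiber (hφ : ∀ (x : X.carrier) (i : ℤ), (π.toFun x).1 i = φ (code R x.1 i))
    (x : X.carrier) : code R x.1 ∈ fiber (code R '' X.carrier) φ (π.toFun x).1 :=
  ⟨⟨x.1, x.2, rfl⟩, fun l => (hφ x l).symm⟩

lemma exists_code_of_mem_fiber
    (hφ : ∀ (x : X.carrier) (i : ℤ), (π.toFun x).1 i = φ (code R x.1 i)) {y : ℤ → B}
    {c : ℤ → Fin (2 * R + 1) → A} (hc : c ∈ fiber (code R '' X.carrier) φ y) :
    ∃ x : X.carrier, code R x.1 = c ∧ (π.toFun x).1 = y := by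
  obtain ⟨⟨x, hx, rfl⟩, h⟩ := hc
  exact ⟨⟨x, hx⟩, rfl, funext fun l => (hφ ⟨x, hx⟩ l).trans (h l)⟩

variable [TopologicalSpace (Fin (2 * R + 1) → A)]

lemma rightTransition_iff (hφ : ∀ (x : X.carrier) (i : ℤ), (π.toFun x).1 i = φ (code R x.1 i))
    (hX : IsMarkov (code R '' X.carrier)) {x x' : X.carrier} :
    π.RightTransition x x' ↔ π.toFun x = π.toFun x' ∧
      Trans (code R '' X.carrier) φ (π.toFun x).1 (code R x.1) (code R x'.1) := by
  constructor
  · intro h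
    refine ⟨(h 0).choose_spec.1, fun m => ?_⟩
    -- A code symbol sees R coordinates on either side, hence the margins R at both ends of the
    -- bridge.
    obtain ⟨z, -, hz, n, hn, h1, h2⟩ := h (m + R)
    refine ⟨n + R, by omega, code R z.1, ⟨_, z.2, rfl⟩, fun l _ _ => by rw [← hz, hφ],
      code_eq_iff.2 fun l hl hl' => h1 _ (by omega), code_eq_iff.2 fun l hl hl' => h2 _ (by omega)⟩
  · rintro ⟨hxx', h⟩ m
    obtain ⟨n, hn, hr⟩ := h (m + R)
    obtain ⟨c, hc, h1, h2⟩ := hr.exists_mem_fiber hX (code_mem_fiber hφ x)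
      (by rw [hxx']; exact code_mem_fiber hφ x') hn
    obtain ⟨z, rfl, hz⟩ := exists_code_of_mem_fiber hφ hc
    exact ⟨z, hxx', Subtype.ext hz, max n (m + 1), by omega,
      fun i hi => apply_eq_of_code_eq (h1 i (by omega)),
      fun i hi => apply_eq_of_code_eq (h2 i (by omega))⟩

lemma leftTransition_iff (hφ : ∀ (x : X.carrier) (i : ℤ), (π.toFun x).1 i = φ (code R x.1 i))
    (hX : IsMarkov (code R '' X.carrier)) {x x' : X.carrier} :
    π.LeftTransition x x' ↔ π.toFun x = π.toFun x' ∧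
      Trans (rev ⁻¹' (code R '' X.carrier)) φ (rev (π.toFun x).1)
        (rev (code R x.1)) (rev (code R x'.1)) := by
  constructor
  · intro h
    refine ⟨(h 0).choose_spec.1, fun m => ?_⟩
    obtain ⟨z, -, hz, n, hn, h1, h2⟩ := h (-m - R)
    refine ⟨R - n, by omega, rev (code R z.1), by simpa using ⟨_, z.2, rfl⟩,
      fun l _ _ => by rw [← hz, rev_apply, rev_apply, hφ],
      code_eq_iff.2 fun l hl hl' => h2 _ (by omega), code_eq_iff.2 fun l hl hl' => h1 _ (by omega)⟩
  · rintro ⟨hxx', h⟩ m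
    obtain ⟨n, hn, hr⟩ := h (-m + R)
    obtain ⟨c, hc, h1, h2⟩ := hr.exists_mem_fiber hX.rev (rev_mem_fiber (code_mem_fiber hφ x))
      (rev_mem_fiber (by rw [hxx']; exact code_mem_fiber hφ x')) hn
    obtain ⟨z, hzc, hz⟩ := exists_code_of_mem_fiber hφ (rev_mem_fiber_of_rev hc)
    obtain rfl : c = rev (code R z.1) := by rw [hzc, rev_rev]
    exact ⟨z, hxx', Subtype.ext hz, min (-n) (m - 1), by omega,
      fun i hi => apply_eq_of_code_eq (by simpa using h2 (-i) (by omega)),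
      fun i hi => apply_eq_of_code_eq (by simpa using h1 (-i) (by omega))⟩

lemma rightEquivalent_iff (hφ : ∀ (x : X.carrier) (i : ℤ), (π.toFun x).1 i = φ (code R x.1 i))
    (hX : IsMarkov (code R '' X.carrier)) {x x' : X.carrier} :
    π.RightEquivalent x x' ↔ π.toFun x = π.toFun x' ∧
      TransEquiv (code R '' X.carrier) φ (π.toFun x).1 (code R x.1) (code R x'.1) := by
  rw [FactorCode.RightEquivalent, rightTransition_iff hφ hX, rightTransition_iff hφ hX]
  constructor
  · rintro ⟨⟨h, h1⟩, h', h2⟩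
    exact ⟨h, h1, by rwa [h]⟩
  · rintro ⟨h, h1, h2⟩
    exact ⟨⟨h, h1⟩, h.symm, by rwa [← h]⟩

lemma leftEquivalent_iff (hφ : ∀ (x : X.carrier) (i : ℤ), (π.toFun x).1 i = φ (code R x.1 i))
    (hX : IsMarkov (code R '' X.carrier)) {x x' : X.carrier} :
    π.LeftEquivalent x x' ↔ π.toFun x = π.toFun x' ∧
      TransEquiv (rev ⁻¹' (code R '' X.carrier)) φ (rev (π.toFun x).1)
        (rev (code R x.1)) (rev (code R x'.1)) := by
  rw [FactorCode.LeftEquivalent, leftTransition_iff hφ hX, leftTransition_iff hφ hX]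
  constructor
  · rintro ⟨⟨h, h1⟩, h', h2⟩
    exact ⟨h, h1, by rwa [h]⟩
  · rintro ⟨h, h1, h2⟩
    exact ⟨⟨h, h1⟩, h.symm, by rwa [← h]⟩

/-- The map τ lets one statement serve both sides: `id` for right classes, `rev` for left ones. -/
lemma setOf_related_eq_iff {S : Type*} [TopologicalSpace S] {C : Set (ℤ → S)} {φ : S → B}
    (hC : IsMarkov C) (τ : (ℤ → B) → ℤ → B) (f : X.carrier → ℤ → S)
    (hf : ∀ x, f x ∈ fiber C φ (τ (π.toFun x).1)) {x x' : X.carrier}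
    (hxx' : π.toFun x = π.toFun x') :
    {u | π.toFun x = π.toFun u ∧ TransEquiv C φ (τ (π.toFun x).1) (f x) (f u)} =
      {u | π.toFun x' = π.toFun u ∧ TransEquiv C φ (τ (π.toFun x').1) (f x') (f u)} ↔
      TransEquiv C φ (τ (π.toFun x).1) (f x) (f x') := by
  rw [← hxx']
  constructor
  · intro h
    have h1 : f x' ∈ fiber C φ (τ (π.toFun x).1) := by rw [hxx']; exact hf x'
    have h2 : x' ∈ {u | π.toFun x = π.toFun u ∧
        TransEquiv C φ (τ (π.toFun x).1) (f x') (f u)} :=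
      ⟨hxx', .of_eventually_eq h1 h1 (N := 0) fun _ _ => rfl⟩
    rw [← h] at h2
    exact h2.2
  · intro h
    ext u
    exact ⟨fun hu => ⟨hu.1, h.symm.trans hC hu.2⟩, fun hu => ⟨hu.1, h.trans hC hu.2⟩⟩

lemma le_rightClassCount_iff
    (hφ : ∀ (x : X.carrier) (i : ℤ), (π.toFun x).1 i = φ (code R x.1 i))
    (hX : IsMarkov (code R '' X.carrier)) (k : ℕ) (y : Y.carrier) :
    k ≤ π.rightClassCount y ↔ HasClasses (code R '' X.carrier) φ k y.1 := by
  have key : ∀ x x', π.toFun x = y → π.toFun x' = y →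
      (π.rightClass x = π.rightClass x' ↔
        TransEquiv (code R '' X.carrier) φ y.1 (code R x.1) (code R x'.1)) := by
    rintro x x' rfl hx'
    simp only [FactorCode.rightClass, rightEquivalent_iff hφ hX]
    exact setOf_related_eq_iff hX id (fun x => code R x.1) (code_mem_fiber hφ) hx'.symm
  rw [FactorCode.rightClassCount, natCast_le_encard_image_iff]
  constructor
  · rintro ⟨f, hf, hne⟩
    refine ⟨fun c => code R (f c).1, fun c => ?_, fun c c' hc h =>
      hne c c' hc ((key _ _ (hf c) (hf c')).2 h)⟩
    have := code_mem_fiber hφ (f c)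
    rwa [show π.toFun (f c) = y from hf c] at this
  · rintro ⟨f, hf, hne⟩
    choose g hg hgy using fun c => exists_code_of_mem_fiber hφ (hf c)
    refine ⟨g, fun c => Subtype.ext (hgy c), fun c c' hc h => hne c c' hc ?_⟩
    rw [← hg, ← hg]
    exact (key _ _ (Subtype.ext (hgy c)) (Subtype.ext (hgy c'))).1 h

lemma le_leftClassCount_iff
    (hφ : ∀ (x : X.carrier) (i : ℤ), (π.toFun x).1 i = φ (code R x.1 i))
    (hX : IsMarkov (code R '' X.carrier)) (k : ℕ) (y : Y.carrier) :
    k ≤ π.leftClassCount y ↔ HasClasses (rev ⁻¹' (code R '' X.carrier)) φ k (rev y.1) := by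
  have key : ∀ x x', π.toFun x = y → π.toFun x' = y →
      (π.leftClass x = π.leftClass x' ↔ TransEquiv (rev ⁻¹' (code R '' X.carrier)) φ (rev y.1)
        (rev (code R x.1)) (rev (code R x'.1))) := by
    rintro x x' rfl hx'
    simp only [FactorCode.leftClass, leftEquivalent_iff hφ hX]
    exact setOf_related_eq_iff hX.rev rev (fun x => rev (code R x.1))
      (fun x => rev_mem_fiber (code_mem_fiber hφ x)) hx'.symm
  rw [FactorCode.leftClassCount, natCast_le_encard_image_iff]
  constructor
  · rintro ⟨f, hf, hne⟩
    refine ⟨fun c => rev (code R (f c).1), fun c => ?_, fun c c' hc h =>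
      hne c c' hc ((key _ _ (hf c) (hf c')).2 h)⟩
    have := rev_mem_fiber (code_mem_fiber hφ (f c))
    rwa [show π.toFun (f c) = y from hf c] at this
  · rintro ⟨f, hf, hne⟩
    choose g hg hgy using fun c => exists_code_of_mem_fiber hφ (rev_mem_fiber_of_rev (hf c))
    refine ⟨g, fun c => Subtype.ext (hgy c), fun c c' hc h => hne c c' hc ?_⟩
    rw [← rev_rev (f c), ← rev_rev (f c'), ← hg, ← hg]
    exact (key _ _ (Subtype.ext (hgy c)) (Subtype.ext (hgy c'))).1 h

lemma isRightClassClosing_iff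
    (hφ : ∀ (x : X.carrier) (i : ℤ), (π.toFun x).1 i = φ (code R x.1 i))
    (hX : IsMarkov (code R '' X.carrier)) :
    π.IsRightClassClosing ↔ IsClosing (code R '' X.carrier) φ := by
  constructor
  · rintro h y c hc c' hc' ⟨n, hn⟩
    obtain ⟨x, rfl, rfl⟩ := exists_code_of_mem_fiber hφ hc
    obtain ⟨x', rfl, hx'⟩ := exists_code_of_mem_fiber hφ hc'
    exact ((rightEquivalent_iff hφ hX).1 (h x x' ⟨n, fun i hi => apply_eq_of_code_eq (hn i hi)⟩
      (Subtype.ext hx'.symm))).2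
  · rintro h x x' ⟨n, hn⟩ hxx'
    exact (rightEquivalent_iff hφ hX).2 ⟨hxx', h _ _ (code_mem_fiber hφ x) _
      (by rw [hxx']; exact code_mem_fiber hφ x')
      ⟨n - R, fun i hi => code_eq_iff.2 fun l hl hl' => hn _ (by omega)⟩⟩

lemma isLeftClassClosing_iff
    (hφ : ∀ (x : X.carrier) (i : ℤ), (π.toFun x).1 i = φ (code R x.1 i))
    (hX : IsMarkov (code R '' X.carrier)) :
    π.IsLeftClassClosing ↔ IsClosing (rev ⁻¹' (code R '' X.carrier)) φ := by
  constructor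
  · rintro h y c hc c' hc' ⟨n, hn⟩
    obtain ⟨y, rfl⟩ : ∃ y', y = rev y' := ⟨rev y, by simp⟩
    obtain ⟨x, hxc, rfl⟩ := exists_code_of_mem_fiber hφ (rev_mem_fiber_of_rev hc)
    obtain ⟨x', hxc', hx'⟩ := exists_code_of_mem_fiber hφ (rev_mem_fiber_of_rev hc')
    obtain rfl : c = rev (code R x.1) := by rw [hxc, rev_rev]
    obtain rfl : c' = rev (code R x'.1) := by rw [hxc', rev_rev]
    exact ((leftEquivalent_iff hφ hX).1 (h x x' ⟨-n, fun i hi =>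
      apply_eq_of_code_eq (by simpa using hn (-i) (by omega))⟩ (Subtype.ext hx'.symm))).2
  · rintro h x x' ⟨n, hn⟩ hxx'
    exact (leftEquivalent_iff hφ hX).2 ⟨hxx', h _ _ (rev_mem_fiber (code_mem_fiber hφ x)) _
      (rev_mem_fiber (by rw [hxx']; exact code_mem_fiber hφ x'))
      ⟨-n - R, fun i hi => code_eq_iff.2 fun l hl hl' => hn _ (by omega)⟩⟩

end Transport

lemma isSubshift_setOf_hasClasses_iff {S : Type*} [TopologicalSpace S] {C : Set (ℤ → S)}
    (hC : IsMarkov C) (φ : S → B) (k : ℕ) :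
    IsSubshift {y | HasClasses C φ k y} ↔ IsClosed {y | HasClasses C φ k y} := by
  refine ⟨fun ⟨Z, hZ⟩ => hZ ▸ Z.isClosed, fun h => ⟨⟨_, h, fun g y hy => ?_⟩, rfl⟩⟩
  have h1 : SymbolicDynamics.FullShift.shift g y = fun l => y (l + g) := by
    ext
    simp [add_comm]
  rw [h1]
  exact HasClasses.shift hC hy g

lemma isSubshift_setOf_hasClasses_rev_iff {S : Type*} [TopologicalSpace S] {C : Set (ℤ → S)}
    (hC : IsMarkov C) (φ : S → B) (k : ℕ) :
    IsSubshift {y | HasClasses C φ k (rev y)} ↔ IsClosed {y | HasClasses C φ k y} := by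
  refine ⟨fun ⟨Z, hZ⟩ => ?_, fun h => ⟨⟨_, h.preimage continuous_rev, fun g y hy => ?_⟩, rfl⟩⟩
  · have h1 := Z.isClosed.preimage (continuous_rev (T := B))
    rw [hZ] at h1
    simpa using h1
  · have := HasClasses.shift hC hy (-g)
    simp only [Set.mem_preimage, Set.mem_ofPred_eq]
    have h1 : rev (SymbolicDynamics.FullShift.shift g y) = fun l => rev y (l + -g) := by
      ext l
      simp only [rev_apply, shift_apply]
      congr 1
      ring
    rwa [h1]

end ClassDegree

theorem mainTheorem8 {A : Type*} {B : Type*}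
    [Finite A] [TopologicalSpace A] [DiscreteTopology A]
    [Finite B] [TopologicalSpace B] [DiscreteTopology B]
    (X : Subshift A ℤ) (Y : Subshift B ℤ)
    (hfin : ClassDegree.IsFiniteType X) (hirr : ClassDegree.IsIrreducible X)
    (π : ClassDegree.FactorCode X Y) :
    (ClassDegree.IsSubshift π.rightMultiplicitySet ↔ π.IsRightClassClosing) ∧
    (ClassDegree.IsSubshift π.leftMultiplicitySet ↔ π.IsLeftClassClosing) ∧
    (π.rightMultiplicitySet = π.leftMultiplicitySet ↔ π.IsBiClassClosing) := by
  open ClassDegree in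
  rcases X.carrier.eq_empty_or_nonempty with hempty | hne
  -- The one-block theorem needs a point; for empty X both multiplicity sets are empty and the
  -- closing conditions vacuous.
  · have hX : IsEmpty X.carrier := by rw [hempty]; infer_instance
    have hY : IsEmpty Y.carrier := ⟨fun y => hX.elim (π.surjective_toFun y).choose⟩
    have hr : π.rightMultiplicitySet = ∅ := by
      rw [FactorCode.rightMultiplicitySet, Set.eq_empty_of_isEmpty {y : Y.carrier | _},
        Set.image_empty]
    have hl : π.leftMultiplicitySet = ∅ := by
      rw [FactorCode.leftMultiplicitySet, Set.eq_empty_of_isEmpty {y : Y.carrier | _},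
        Set.image_empty]
    have hsub : IsSubshift (∅ : Set (ℤ → B)) :=
      ⟨⟨∅, isClosed_empty, fun _ => Set.mapsTo_empty _ _⟩, rfl⟩
    have hrc : π.IsRightClassClosing := fun x => hX.elim x
    have hlc : π.IsLeftClassClosing := fun x => hX.elim x
    rw [hr, hl]
    exact ⟨iff_of_true hsub hrc, iff_of_true hsub hlc, iff_of_true rfl ⟨hrc, hlc⟩⟩
  obtain ⟨k, hk⟩ := hfin.isMarkov_code hirr
  obtain ⟨r, hr⟩ := π.exists_blockMap hne
  obtain ⟨φ, hφ⟩ := hr (max k r) (le_max_right _ _)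
  have hC := hk (max k r) (by have := le_max_left k r; omega)
  generalize max k r = R at φ hφ hC
  obtain ⟨d, hd, ⟨y₀, ⟨x₀, hx₀⟩, hy₀⟩, h1, h2, h3⟩ := exists_classDegree hC (hne.image _) φ
  have hdeg : π.classDegree = d := by
    refine le_antisymm ?_ (le_iInf fun y => ?_)
    · obtain ⟨x, -, rfl⟩ := exists_code_of_mem_fiber hφ hx₀
      refine (iInf_le _ (π.toFun x)).trans ?_
      rw [← le_rightClassCount_iff hφ hC, not_le, Nat.cast_add, Nat.cast_one] at hy₀
      exact (ENat.lt_add_one_iff (ENat.natCast_ne_top d)).1 hy₀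
    · obtain ⟨x, rfl⟩ := π.surjective_toFun y
      exact (le_rightClassCount_iff hφ hC d _).2 (hd _ ⟨_, code_mem_fiber hφ x⟩).1
  have hlt : ∀ n : ℕ∞, (d : ℕ∞) < n ↔ ((d + 1 : ℕ) : ℕ∞) ≤ n := fun n => by
    rw [Nat.cast_add, Nat.cast_one, ENat.add_one_le_iff (ENat.natCast_ne_top d)]
  have hMr : π.rightMultiplicitySet = {y | HasClasses (code R '' X.carrier) φ (d + 1) y} := by
    ext y
    simp only [FactorCode.rightMultiplicitySet, hdeg, hlt, le_rightClassCount_iff hφ hC]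
    refine ⟨by rintro ⟨y, hy, rfl⟩; exact hy, fun hy => ?_⟩
    -- A class exists because d + 1 > 0, so the fiber is nonempty and y lies in Y.
    obtain ⟨f, hf, -⟩ := id hy
    obtain ⟨x, -, rfl⟩ := exists_code_of_mem_fiber hφ (hf 0)
    exact ⟨π.toFun x, hy, rfl⟩
  have hMl : π.leftMultiplicitySet =
      {y | HasClasses (rev ⁻¹' (code R '' X.carrier)) φ (d + 1) (rev y)} := by
    ext y
    simp only [FactorCode.leftMultiplicitySet, hdeg, hlt, le_leftClassCount_iff hφ hC]
    refine ⟨by rintro ⟨y, hy, rfl⟩; exact hy, fun hy => ?_⟩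
    obtain ⟨f, hf, -⟩ := id hy
    obtain ⟨x, -, rfl⟩ := exists_code_of_mem_fiber hφ (rev_mem_fiber_of_rev (hf 0))
    exact ⟨π.toFun x, hy, rfl⟩
  rw [hMr, hMl, FactorCode.IsBiClassClosing, isRightClassClosing_iff hφ hC,
    isLeftClassClosing_iff hφ hC, isSubshift_setOf_hasClasses_iff hC,
    isSubshift_setOf_hasClasses_rev_iff hC.rev]
  exact ⟨h1, h2, h3⟩
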